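/- Let $\Phi$ be an irreducible (reduced, crystallographic) root system whose Dynkin diagram $X_n$ is simply laced, with inner product normalised so that $(\alpha|\alpha)=2$ for all $\alpha\in\Phi$, and fix simple roots $\alpha_1,\dots,\alpha_n$. A *Chevalley spanning set of type $X_n$* of a Lie algebra $L$ over a field $F$ is a family of elements $x_\alpha,h_\alpha\in L$ ($\alpha\in\Phi$) which spans $L$ over $F$ and satisfies, for all $\alpha,\beta\in\Phi$: (i) $[h_\alpha,h_\beta]=0$; (ii) $[h_\alpha,x_\beta]=(\alpha|\beta)x_\beta$; (iii) if $\alpha+\beta=0$ then $[x_\alpha,x_\beta]=h_\alpha$; (iv) if $\alpha+\beta$ is a root then $[x_\alpha,x_\beta]=A_{\alpha,\beta}x_{\alpha+\beta}$ for some $0\neq A_{\alpha,\beta}\in F$, and if $\alpha+\beta$ is neither $0$ nor a root then $[x_\alpha,x_\beta]=0$. A *Chevalley basis of type $X_n$* of a simple complex Lie algebra $\mathfrak g$ is a basis $\{x_\alpha,\ h_{\alpha_i}\mid \alpha\in\Phi,\ 1\le i\le n\}$ of $\mathfrak g$ coming from a Chevalley spanning set of type $X_n$ of $\mathfrak g$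 all of whose nonzero structure constants $A_{\alpha,\beta}$ are $\pm1$. Its integral span $\mathfrak g_{\mathbb Z}$ is closed under the Lie product, and $\mathfrak g_{\mathbb Z}\otimes_{\mathbb Z}F$ is the *Chevalley algebra* of type $X_n$ over $F$. Then a simple complex Lie algebra $\mathfrak g$ with a Chevalley basis of type $X_n$ exists, and for every such $\mathfrak g$ and Chevalley basis, every field $F$ and every Lie algebra $L$ over $F$ the following are equivalent: (a) $L\neq0$ and $L$ has a Chevalley spanning set of type $X_n$; (b) $L$ has a Chevalley spanning set of type $X_n$ with all $x_\alpha\neq0$; (c) $L$ is classical of type $X_n$, that is, $L$ is nonzero and isomorphic to a quotient of the Chevalley algebra $\mathfrak g_{\mathbb Z}\otimes_{\mathbb Z}F$ by an ideal. -/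

import Mathlib

open scoped TensorProduct

universe u

namespace SimplyLaced

variable {ι M N : Type*} [AddCommGroup M] [Module ℝ M] [AddCommGroup N] [Module ℝ N]

/-- A Chevalley spanning set of a Lie algebra `L` over `F`, of the type of the (simply-laced) root
system `P`: elements `x α`, `h α` indexed by the roots `α`, which span `L` and satisfy the four
families of relations. In a simply-laced root system the standard inner product is normalised by
`(α|α) = 2`, so that `(α|β) = 2 (α|β) / (β|β)` is the integer `P.pairingIn ℤ α β`. -/
structure IsChevalleySpanningSet (P : RootPairing ι ℝ M N) [P.IsCrystallographic]
    (F : Type*) [Field F] {L : Type*} [LieRing L] [LieAlgebra F L] (x h : ι → L) : Prop where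
  span_eq_top : Submodule.span F (Set.range x ∪ Set.range h) = ⊤
  lie_h_h : ∀ α β, ⁅h α, h β⁆ = 0
  lie_h_x : ∀ α β, ⁅h α, x β⁆ = ((P.pairingIn ℤ α β : ℤ) : F) • x β
  lie_x_neg : ∀ α β, P.root α + P.root β = 0 → ⁅x α, x β⁆ = h α
  /-- If `α + β` is a root `γ`, then `[x_α, x_β] = A x_γ` with `A ≠ 0`. -/
  lie_x_x : ∀ α β γ, P.root α + P.root β = P.root γ → ∃ A : F, A ≠ 0 ∧ ⁅x α, x β⁆ = A • x γ
  /-- If `α + β` is neither zero nor a root, then the structure constant is zero. -/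
  lie_x_x_eq_zero : ∀ α β, P.root α + P.root β ≠ 0 → P.root α + P.root β ∉ Set.range P.root →
    ⁅x α, x β⁆ = 0

/-- A Lie algebra over `F` has a Chevalley spanning set of the type of `P`. -/
def HasChevalleySpanningSet (P : RootPairing ι ℝ M N) [P.IsCrystallographic]
    (F : Type*) [Field F] (L : Type*) [LieRing L] [LieAlgebra F L] : Prop :=
  ∃ x h : ι → L, IsChevalleySpanningSet P F x h

/-- `g` is a simple complex Lie algebra with root system `P`, and the `x α` together with the `h i`,
`i` running over the simple roots of the base `b`, are a Chevalley basis of it. The correspondence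
between `g` and `P` is carried by the relations: the span of the `h i` is a Cartan subalgebra, with
root spaces `ℂ x α` and roots `h β ↦ (α|β)`. -/
structure IsChevalleyBasis {P : RootPairing ι ℝ M N} [P.IsCrystallographic] (b : P.Base)
    {g : Type*} [LieRing g] [LieAlgebra ℂ g] (x h : ι → g) : Prop where
  isSimple : LieAlgebra.IsSimple ℂ g
  isChevalleySpanningSet : IsChevalleySpanningSet P ℂ x h
  linearIndependent : LinearIndependent ℂ (Sum.elim x fun i : b.support => h i)
  span_basis_eq_top : Submodule.span ℂ (Set.range x ∪ h '' b.support) = ⊤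
  /-- The nonzero structure constants are `±1`. -/
  lie_x_x_eq_or : ∀ α β γ, P.root α + P.root β = P.root γ → ⁅x α, x β⁆ = x γ ∨ ⁅x α, x β⁆ = -x γ

namespace IsChevalleyBasis

variable {P : RootPairing ι ℝ M N} [P.IsCrystallographic] {b : P.Base}
  {g : Type*} [LieRing g] [LieAlgebra ℂ g] {x h : ι → g}

/-- An element commuting with a Chevalley basis is zero. -/
theorem eq_zero_of_lie (hb : IsChevalleyBasis b x h) {z : g}
    (hx : ∀ α, ⁅z, x α⁆ = 0) (hh : ∀ α, ⁅z, h α⁆ = 0) : z = 0 := by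
  have := hb.isSimple
  have hz : ∀ y : g, ⁅z, y⁆ = 0 := by
    intro y
    have hy : y ∈ Submodule.span ℂ (Set.range x ∪ Set.range h) := by
      rw [hb.isChevalleySpanningSet.span_eq_top]; trivial
    induction hy using Submodule.span_induction with
    | mem y hy =>
      rcases hy with ⟨α, rfl⟩ | ⟨α, rfl⟩
      · exact hx α
      · exact hh α
    | zero => simp
    | add y₁ y₂ _ _ h₁ h₂ => simp [h₁, h₂]
    | smul c y _ h₁ => simp [h₁]
  have hc : z ∈ LieAlgebra.center ℂ g := by
    rw [LieModule.mem_maxTrivSubmodule]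
    intro y
    rw [← lie_skew, hz, neg_zero]
  rcases hb.isSimple.eq_bot_or_eq_top (LieAlgebra.center ℂ g) with h0 | h1
  · rw [h0] at hc
    simpa using hc
  · exact absurd ((LieAlgebra.isLieAbelian_iff_center_eq_top ℂ g).2 h1) hb.isSimple.non_abelian

/-- Every `h α` is an integral combination of the `h i` for the simple roots `i`. -/
theorem h_mem_span (hb : IsChevalleyBasis b x h) (α : ι) :
    h α ∈ Submodule.span ℤ (h '' b.support) := by
  have key : ∀ m ∈ Submodule.span ℤ (P.root '' b.support),
      ∃ z ∈ Submodule.span ℤ (h '' b.support), (∀ β, ⁅z, h β⁆ = 0) ∧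
        ∀ β, ⁅z, x β⁆ = ((P.toLinearMap m (P.coroot β) : ℝ) : ℂ) • x β := by
    intro m hm
    induction hm using Submodule.span_induction with
    | mem m hm =>
      obtain ⟨i, hi, rfl⟩ := hm
      refine ⟨h i, Submodule.subset_span ⟨i, hi, rfl⟩,
        hb.isChevalleySpanningSet.lie_h_h i, fun β => ?_⟩
      rw [hb.isChevalleySpanningSet.lie_h_x, RootPairing.root_coroot_eq_pairing,
        ← P.algebraMap_pairingIn ℤ]
      simp
    | zero => exact ⟨0, Submodule.zero_mem _, by simp, by simp⟩
    | add m₁ m₂ _ _ h₁ h₂ =>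
      obtain ⟨z₁, hz₁, ha₁, hc₁⟩ := h₁
      obtain ⟨z₂, hz₂, ha₂, hc₂⟩ := h₂
      refine ⟨z₁ + z₂, Submodule.add_mem _ hz₁ hz₂, fun β => by simp [ha₁, ha₂], fun β => ?_⟩
      simp only [add_lie, hc₁, hc₂, map_add, LinearMap.add_apply, Complex.ofReal_add, add_smul]
    | smul c m _ h₁ =>
      obtain ⟨z, hz, ha, hc⟩ := h₁
      refine ⟨c • z, Submodule.smul_mem _ c hz, fun β => by simp [ha], fun β => ?_⟩
      rw [zsmul_lie, hc, map_zsmul, LinearMap.smul_apply, zsmul_eq_mul, Complex.ofReal_mul,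
        mul_smul, Complex.ofReal_intCast, Int.cast_smul_eq_zsmul]
  obtain ⟨z, hz, ha, hc⟩ := key _ (b.root_mem_span_int α)
  have : h α - z = 0 := by
    refine hb.eq_zero_of_lie (fun β => ?_) fun β => ?_
    · rw [sub_lie, hc, hb.isChevalleySpanningSet.lie_h_x, RootPairing.root_coroot_eq_pairing,
        ← P.algebraMap_pairingIn ℤ]
      simp
    · rw [sub_lie, ha, hb.isChevalleySpanningSet.lie_h_h, sub_zero]
  rwa [sub_eq_zero.1 this]

/-- The integral span of a Chevalley basis is closed under the Lie product. -/
theorem lie_mem_span (hb : IsChevalleyBasis b x h) {y z : g}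
    (hy : y ∈ Submodule.span ℤ (Set.range x ∪ h '' b.support))
    (hz : z ∈ Submodule.span ℤ (Set.range x ∪ h '' b.support)) :
    ⁅y, z⁆ ∈ Submodule.span ℤ (Set.range x ∪ h '' b.support) := by
  have hh : ∀ α, h α ∈ Submodule.span ℤ (Set.range x ∪ h '' b.support) := fun α =>
    Submodule.span_mono Set.subset_union_right (hb.h_mem_span α)
  have hx : ∀ α, x α ∈ Submodule.span ℤ (Set.range x ∪ h '' b.support) := fun α =>
    Submodule.subset_span (Or.inl ⟨α, rfl⟩)
  have hhx : ∀ α β, ⁅h α, x β⁆ ∈ Submodule.span ℤ (Set.range x ∪ h '' b.support) := by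
    intro α β
    rw [hb.isChevalleySpanningSet.lie_h_x, Int.cast_smul_eq_zsmul]
    exact Submodule.smul_mem _ _ (hx β)
  induction hy, hz using Submodule.span_induction₂ with
  | mem_mem y z hy hz =>
    rcases hy with ⟨α, rfl⟩ | ⟨α, -, rfl⟩ <;> rcases hz with ⟨β, rfl⟩ | ⟨β, -, rfl⟩
    · by_cases h0 : P.root α + P.root β = 0
      · rw [hb.isChevalleySpanningSet.lie_x_neg α β h0]
        exact hh α
      · by_cases h1 : P.root α + P.root β ∈ Set.range P.root
        · obtain ⟨γ, hγ⟩ := h1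
          rcases hb.lie_x_x_eq_or α β γ hγ.symm with h2 | h2 <;> rw [h2]
          · exact hx γ
          · exact Submodule.neg_mem _ (hx γ)
        · rw [hb.isChevalleySpanningSet.lie_x_x_eq_zero α β h0 h1]
          exact Submodule.zero_mem _
    · rw [← lie_skew]
      exact Submodule.neg_mem _ (hhx β α)
    · exact hhx α β
    · rw [hb.isChevalleySpanningSet.lie_h_h]
      exact Submodule.zero_mem _
  | zero_left z _ => rw [zero_lie]; exact Submodule.zero_mem _
  | zero_right y _ => rw [lie_zero]; exact Submodule.zero_mem _
  | add_left y₁ y₂ z _ _ _ h₁ h₂ => rw [add_lie]; exact Submodule.add_mem _ h₁ h₂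
  | add_right y z₁ z₂ _ _ _ h₁ h₂ => rw [lie_add]; exact Submodule.add_mem _ h₁ h₂
  | smul_left c y z _ _ h₁ => rw [zsmul_lie]; exact Submodule.smul_mem _ c h₁
  | smul_right c y z _ _ h₁ => rw [lie_zsmul]; exact Submodule.smul_mem _ c h₁

/-- The Lie ring `g_ℤ`: the integral span of a Chevalley basis. -/
def lattice (hb : IsChevalleyBasis b x h) : LieSubalgebra ℤ g where
  toSubmodule := Submodule.span ℤ (Set.range x ∪ h '' b.support)
  lie_mem' := hb.lie_mem_span

/-- `L` is classical over `F`: a nonzero quotient of the Chevalley algebra `g_ℤ ⊗ F`. -/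
def IsClassical (hb : IsChevalleyBasis b x h)
    (F : Type*) [Field F] (L : Type*) [LieRing L] [LieAlgebra F L] : Prop :=
  Nontrivial L ∧ ∃ I : LieIdeal F (F ⊗[ℤ] hb.lattice), Nonempty (L ≃ₗ⁅F⁆ (F ⊗[ℤ] hb.lattice) ⧸ I)

end IsChevalleyBasis

end SimplyLaced

namespace SimplyLaced

section RootCombinatorics

variable {ι M N : Type*} [AddCommGroup M] [Module ℝ M] [AddCommGroup N] [Module ℝ N]
  {P : RootPairing ι ℝ M N} [P.IsCrystallographic]

theorem pairingIn_add_left {α β γ : ι} (hγ : P.root γ = P.root α + P.root β) (δ : ι) :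
    P.pairingIn ℤ γ δ = P.pairingIn ℤ α δ + P.pairingIn ℤ β δ :=
  P.pairingIn_eq_add_of_root_eq_add hγ

theorem pairingIn_neg_left {α β : ι} (hβ : P.root β = -P.root α) (δ : ι) :
    P.pairingIn ℤ β δ = -P.pairingIn ℤ α δ := by
  apply FaithfulSMul.algebraMap_injective ℤ ℝ
  simp only [P.algebraMap_pairingIn, map_neg, ← RootPairing.root_coroot_eq_pairing, hβ,
    LinearMap.neg_apply]

/-- The Cartan integers of a simply-laced root system are symmetric. -/
theorem pairingIn_comm [Finite ι] [P.IsRootSystem] [P.IsReduced] (b : P.Base)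
    (hP : b.cartanMatrix.IsSimplyLaced) (α β : ι) :
    P.pairingIn ℤ α β = P.pairingIn ℤ β α := by
  have hsimple : ∀ i j : b.support, P.pairingIn ℤ i j = P.pairingIn ℤ j i := by
    intro i j
    rcases eq_or_ne i j with rfl | hij
    · rfl
    · have h1 := hP hij
      have h2 := hP hij.symm
      have h3 := b.cartanMatrix_apply_eq_zero_iff_symm (i := i) (j := j)
      simp only [RootPairing.Base.cartanMatrix, RootPairing.Base.cartanMatrixIn_def] at h1 h2 h3
      omega
  let D : M →ₗ[ℝ] N := b.toWeightBasis.constr ℝ fun i => P.coroot i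
  have hD : ∀ i : b.support, D (P.root i) = P.coroot i := fun i => by
    rw [← b.toWeightBasis_apply i, Module.Basis.constr_basis]
  have hsymm : ∀ m m', P.toLinearMap m (D m') = P.toLinearMap m' (D m) := by
    intro m m'
    have : P.toLinearMap.compl₂ D = (P.toLinearMap.compl₂ D).flip := by
      refine b.toWeightBasis.ext fun i => b.toWeightBasis.ext fun j => ?_
      simp only [RootPairing.Base.toWeightBasis_apply, LinearMap.compl₂_apply,
        LinearMap.flip_apply, hD, RootPairing.root_coroot_eq_pairing, ← P.algebraMap_pairingIn ℤ,
        hsimple i j]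
    exact LinearMap.congr_fun₂ this m m'
  have hroot : ∀ α, D (P.root α) = P.coroot α := by
    intro α
    induction α using b.induction_reflect with
    | h₀ i hi => simp [hi]
    | h₁ i hi => exact hD ⟨i, hi⟩
    | h₂ i j hi hj =>
      rw [P.root_reflectionPerm, P.coroot_reflectionPerm, P.reflection_apply, P.coreflection_apply,
        map_sub, map_smul, hi, hD ⟨j, hj⟩]
      congr 2
      change P.toLinearMap (P.root i) (P.coroot j) = P.toLinearMap (P.root j) (P.coroot i)
      rw [← hi, hsymm, hD ⟨j, hj⟩]
  apply FaithfulSMul.algebraMap_injective ℤ ℝ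
  simp only [P.algebraMap_pairingIn, ← RootPairing.root_coroot_eq_pairing, ← hroot]
  exact hsymm _ _

section Symm

variable (hs : ∀ α β, P.pairingIn ℤ α β = P.pairingIn ℤ β α)

include hs

theorem pairingIn_add_right {α β γ : ι} (hγ : P.root γ = P.root α + P.root β) (δ : ι) :
    P.pairingIn ℤ δ γ = P.pairingIn ℤ δ α + P.pairingIn ℤ δ β := by
  rw [hs δ, hs δ, hs δ, pairingIn_add_left hγ]

theorem pairingIn_neg_right {α β : ι} (hβ : P.root β = -P.root α) (δ : ι) :
    P.pairingIn ℤ δ β = -P.pairingIn ℤ δ α := by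
  rw [hs δ, hs δ, pairingIn_neg_left hβ]

theorem pairingIn_eq_two_iff [Finite ι] [P.IsRootSystem] {α β : ι} :
    P.pairingIn ℤ α β = 2 ↔ α = β := by
  rw [← P.pairingIn_two_two_iff ℤ α β, hs β α, and_self]

theorem pairingIn_eq_neg_two_iff [Finite ι] [P.IsRootSystem] {α β : ι} :
    P.pairingIn ℤ α β = -2 ↔ P.root α = -P.root β := by
  rw [← P.pairingIn_neg_two_neg_two_iff ℤ α β, hs β α, and_self]

theorem abs_pairingIn_le_two [Finite ι] (α β : ι) :
    -2 ≤ P.pairingIn ℤ α β ∧ P.pairingIn ℤ α β ≤ 2 := by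
  have h1 := P.pairingIn_pairingIn_mem_set_of_isCrystallographic α β
  have h2 := hs α β
  simp only [Set.mem_insert_iff, Set.mem_singleton_iff, Prod.mk.injEq] at h1
  omega

theorem pairingIn_eq_neg_one_of_root_eq_add {α β γ : ι}
    (hγ : P.root γ = P.root α + P.root β) : P.pairingIn ℤ α β = -1 := by
  have h1 := pairingIn_add_left hγ γ
  rw [P.pairingIn_same, hs α γ, hs β γ, pairingIn_add_left hγ, pairingIn_add_left hγ, hs β α] at h1
  simp only [P.pairingIn_same] at h1
  omega

omit hs in
theorem root_reflectionPerm_of_pairingIn_eq_neg_one {α β : ι} (h : P.pairingIn ℤ α β = -1) :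
    P.root (P.reflectionPerm β α) = P.root α + P.root β := by
  rw [P.root_reflectionPerm, P.reflection_apply_root' ℤ, h]
  simp

end Symm

omit [P.IsCrystallographic] in
variable (P) in
theorem exists_root_eq_neg (α : ι) : ∃ α', P.root α' = -P.root α :=
  ⟨P.reflectionPerm α α, by simp⟩

omit [P.IsCrystallographic] in
variable (P) in
theorem nonempty_of_isIrreducible [P.IsRootSystem] [P.IsIrreducible] : Nonempty ι := by
  by_contra hne
  rw [not_nonempty_iff] at hne
  have := RootPairing.IsIrreducible.nontrivial P
  have h1 := RootPairing.IsRootSystem.span_root_eq_top (P := P)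
  rw [Set.range_eq_empty, Submodule.span_empty] at h1
  exact bot_ne_top h1

/-- A nonempty set of roots containing every root not orthogonal to one of its members is
everything. -/
theorem mem_of_forall_pairingIn_ne_zero [P.IsIrreducible] (S : Set ι) (hne : S.Nonempty)
    (hS : ∀ α ∈ S, ∀ β, P.pairingIn ℤ α β ≠ 0 → β ∈ S) (β : ι) : β ∈ S := by
  by_contra hβ
  have hspan : Submodule.span ℝ (P.root '' S) = ⊤ := by
    refine P.span_root_image_eq_top_of_forall_orthogonal S hne fun j hj i hi => ?_
    have : P.pairingIn ℤ i j = 0 := by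
      by_contra h
      exact hj (Submodule.subset_span ⟨j, hS i hi j h, rfl⟩)
    have h2 : P.pairing i j = 0 := by rw [← P.algebraMap_pairingIn ℤ, this, map_zero]
    exact ⟨(P.pairing_eq_zero_iff' (i := i) (j := j)).1 h2, h2⟩
  have hle : Submodule.span ℝ (P.root '' S) ≤ LinearMap.ker (P.coroot' β) := by
    rw [Submodule.span_le]
    rintro _ ⟨α, hα, rfl⟩
    have : P.pairingIn ℤ α β = 0 := by
      by_contra h
      exact hβ (hS α hα β h)
    have h2 : P.pairing α β = 0 := by rw [← P.algebraMap_pairingIn ℤ, this, map_zero]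
    simpa using h2
  have h3 : P.root β ∈ LinearMap.ker (P.coroot' β) := hle (hspan ▸ Submodule.mem_top)
  simp at h3

/-- A bimultiplicative sign on the roots of a simply-laced root system, whose commutator is the
parity of the Cartan integer. -/
theorem exists_sign_form [Finite ι] [P.IsRootSystem] (b : P.Base)
    (hs : ∀ α β, P.pairingIn ℤ α β = P.pairingIn ℤ β α) :
    ∃ ε : ι → ι → ℤˣ,
      (∀ α β γ δ, P.root γ = P.root α + P.root β → ε γ δ = ε α δ * ε β δ) ∧
      (∀ α β γ δ, P.root γ = P.root α + P.root β → ε δ γ = ε δ α * ε δ β) ∧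
      (∀ α β δ, P.root β = -P.root α → ε β δ = ε α δ) ∧
      (∀ α β δ, P.root β = -P.root α → ε δ β = ε δ α) ∧
      (∀ α β, ε α β * ε β α = Int.negOnePow (P.pairingIn ℤ α β)) ∧
      ∀ α, ε α α = -1 := by
  classical
  obtain ⟨e⟩ : Nonempty (b.support ≃ Fin (Fintype.card b.support)) :=
    ⟨Fintype.equivFin b.support⟩
  let F : b.support → b.support → ℤ := fun i j =>
    if i = j then 1 else if e i < e j then P.pairingIn ℤ i j else 0
  have hF : ∀ i j, F i j + F j i = P.pairingIn ℤ i j := by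
    intro i j
    rcases eq_or_ne i j with rfl | hij
    · simp [F]
    · rcases lt_or_gt_of_ne (e.injective.ne hij) with h | h
      · simp [F, hij, hij.symm, h, h.not_gt]
      · simp [F, hij, hij.symm, h, h.not_gt, hs j i]
  let a : ι → b.support → ℤ := fun α i => b.toWeightBasisInt.repr (P.rootSpanMem ℤ α) i
  have ha_add : ∀ α β γ, P.root γ = P.root α + P.root β → a γ = a α + a β := by
    intro α β γ h
    have : P.rootSpanMem ℤ γ = P.rootSpanMem ℤ α + P.rootSpanMem ℤ β := Subtype.ext h
    funext i
    simp only [a, this, map_add, Finsupp.add_apply, Pi.add_apply]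
  have ha_neg : ∀ α β, P.root β = -P.root α → a β = -a α := by
    intro α β h
    have : P.rootSpanMem ℤ β = -P.rootSpanMem ℤ α := Subtype.ext h
    funext i
    simp only [a, this, map_neg, Finsupp.neg_apply, Pi.neg_apply]
  have ha_root : ∀ α, P.root α = ∑ i, a α i • P.root i := by
    intro α
    have := congrArg Subtype.val (b.toWeightBasisInt.sum_repr (P.rootSpanMem ℤ α))
    simpa [a] using this.symm
  have hp_left : ∀ α β, P.pairingIn ℤ α β = ∑ i, a α i * P.pairingIn ℤ i β := by
    intro α β
    apply FaithfulSMul.algebraMap_injective ℤ ℝ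
    simp only [map_sum, map_mul, P.algebraMap_pairingIn]
    rw [← RootPairing.root_coroot_eq_pairing, ha_root α]
    simp
  let f : ι → ι → ℤ := fun α β => ∑ i, ∑ j, a α i * a β j * F i j
  have hf : ∀ α β, f α β + f β α = P.pairingIn ℤ α β := by
    intro α β
    have h1 : f β α = ∑ i, ∑ j, a α i * a β j * F j i := by
      simp only [f]
      rw [Finset.sum_comm]
      exact Finset.sum_congr rfl fun i _ => Finset.sum_congr rfl fun j _ => by ring
    rw [h1, ← Finset.sum_add_distrib, hp_left]
    refine Finset.sum_congr rfl fun i _ => ?_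
    rw [hs, hp_left, ← Finset.sum_add_distrib, Finset.mul_sum]
    refine Finset.sum_congr rfl fun j _ => ?_
    rw [hs, ← hF i j]
    ring
  refine ⟨fun α β => Int.negOnePow (f α β), ?_, ?_, ?_, ?_, ?_, ?_⟩
  · intro α β γ δ h
    rw [← Int.negOnePow_add]
    simp only [f, ha_add α β γ h, Pi.add_apply, add_mul, Finset.sum_add_distrib]
  · intro α β γ δ h
    rw [← Int.negOnePow_add]
    simp only [f, ha_add α β γ h, Pi.add_apply, add_mul, mul_add, Finset.sum_add_distrib]
  · intro α β δ h
    change Int.negOnePow _ = Int.negOnePow _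
    rw [← Int.negOnePow_neg]
    simp only [f, ha_neg α β h, Pi.neg_apply, neg_mul, Finset.sum_neg_distrib, neg_neg]
  · intro α β δ h
    change Int.negOnePow _ = Int.negOnePow _
    rw [← Int.negOnePow_neg]
    simp only [f, ha_neg α β h, Pi.neg_apply, mul_neg, neg_mul, Finset.sum_neg_distrib, neg_neg]
  · intro α β
    rw [← Int.negOnePow_add, hf]
  · intro α
    have := hf α α
    rw [P.pairingIn_same] at this
    have h1 : f α α = 1 := by omega
    simp [h1]

end RootCombinatorics

section StructureConstants

variable {ι M N : Type*} [AddCommGroup M] [Module ℝ M] [AddCommGroup N] [Module ℝ N]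
  {P : RootPairing ι ℝ M N} [P.IsCrystallographic]
  {F L : Type*} [Field F] [LieRing L] [LieAlgebra F L] {x h : ι → L}

namespace IsChevalleySpanningSet

theorem exists_structure_constants (hx : IsChevalleySpanningSet P F x h) :
    ∃ A : ι → ι → F, ∀ α β γ, P.root γ = P.root α + P.root β →
      A α β ≠ 0 ∧ ⁅x α, x β⁆ = A α β • x γ := by
  classical
  refine ⟨fun α β => if h : ∃ γ, P.root γ = P.root α + P.root β then
    (hx.lie_x_x α β h.choose h.choose_spec.symm).choose else 0, fun α β γ hγ => ?_⟩
  have hex : ∃ γ, P.root γ = P.root α + P.root β := ⟨γ, hγ⟩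
  have hγ' : hex.choose = γ := P.root.injective (hex.choose_spec.trans hγ.symm)
  have := (hx.lie_x_x α β hex.choose hex.choose_spec.symm).choose_spec
  simp only [dif_pos hex]
  exact ⟨this.1, this.2.trans (congrArg (fun δ => (_ : F) • x δ) hγ')⟩

/-- The chosen nonzero structure constants of a Chevalley spanning set. -/
noncomputable def coeff (hx : IsChevalleySpanningSet P F x h) : ι → ι → F :=
  hx.exists_structure_constants.choose

variable (hx : IsChevalleySpanningSet P F x h)

theorem coeff_ne_zero {α β γ : ι} (hγ : P.root γ = P.root α + P.root β) :
    hx.coeff α β ≠ 0 :=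
  (hx.exists_structure_constants.choose_spec α β γ hγ).1

theorem lie_eq_coeff_smul {α β γ : ι} (hγ : P.root γ = P.root α + P.root β) :
    ⁅x α, x β⁆ = hx.coeff α β • x γ :=
  (hx.exists_structure_constants.choose_spec α β γ hγ).2

include hx in
theorem lie_x_self_neg {α α' : ι} (hα : P.root α' = -P.root α) : ⁅x α, x α'⁆ = h α :=
  hx.lie_x_neg α α' (by rw [hα, add_neg_cancel])

include hx in
theorem h_neg {α α' : ι} (hα : P.root α' = -P.root α) : h α' = -h α := by
  rw [← hx.lie_x_self_neg hα, lie_skew, hx.lie_x_neg α' α (by rw [hα, neg_add_cancel])]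

variable (h0 : ∀ α, x α ≠ 0)

include h0

theorem coeff_swap {α β γ : ι} (hγ : P.root γ = P.root α + P.root β) :
    hx.coeff β α = -hx.coeff α β := by
  have h1 := hx.lie_eq_coeff_smul hγ
  rw [← lie_skew, hx.lie_eq_coeff_smul (hγ.trans (add_comm _ _)), ← neg_smul] at h1
  have := smul_left_injective F (h0 γ) h1
  rw [← this, neg_neg]

variable (hs : ∀ α β, P.pairingIn ℤ α β = P.pairingIn ℤ β α)

include hs

omit h0 in
include hx in
/-- If `α + β` is a root, then `β - α` is neither a root nor zero. -/
theorem lie_neg_eq_zero {α β γ α' : ι} (hγ : P.root γ = P.root α + P.root β)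
    (hα : P.root α' = -P.root α) : ⁅x α', x β⁆ = 0 := by
  have h1 := pairingIn_eq_neg_one_of_root_eq_add hs hγ
  refine hx.lie_x_x_eq_zero α' β (fun h2 => ?_) ?_
  · rw [hα, neg_add_eq_zero] at h2
    rw [P.root.injective h2, P.pairingIn_same] at h1
    omega
  · rintro ⟨δ, hδ⟩
    have h2 := pairingIn_eq_neg_one_of_root_eq_add hs hδ
    rw [pairingIn_neg_left hα] at h2
    omega

theorem coeff_mul_coeff_neg {α β γ α' : ι} (hγ : P.root γ = P.root α + P.root β)
    (hα : P.root α' = -P.root α) : hx.coeff α β * hx.coeff α' γ = 1 := by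
  have h1 := pairingIn_eq_neg_one_of_root_eq_add hs hγ
  have h2 : P.root β = P.root α' + P.root γ := by rw [hα, hγ]; abel
  have h3 : ⁅x α', ⁅x α, x β⁆⁆ = x β := by
    rw [leibniz_lie, hx.lie_neg_eq_zero hs hγ hα, lie_zero, add_zero,
      hx.lie_x_neg α' α (by rw [hα, neg_add_cancel]), hx.lie_h_x, pairingIn_neg_left hα, h1]
    simp
  rw [hx.lie_eq_coeff_smul hγ, lie_smul, hx.lie_eq_coeff_smul h2, smul_smul] at h3
  exact smul_left_injective F (h0 β) (by simpa using h3)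

theorem coeff_cyclic {α β γ : ι} (hsum : P.root α + P.root β + P.root γ = 0) :
    hx.coeff α β = hx.coeff γ α := by
  obtain ⟨β', hβ⟩ : ∃ β', P.root β' = -P.root β := exists_root_eq_neg P β
  obtain ⟨γ', hγ⟩ : ∃ γ', P.root γ' = -P.root γ := exists_root_eq_neg P γ
  have e1 : P.root γ' = P.root α + P.root β := by
    rw [hγ, eq_comm, eq_neg_iff_add_eq_zero, hsum]
  have e2 : P.root β' = P.root γ + P.root α := by
    rw [hβ, eq_comm, eq_neg_iff_add_eq_zero, ← hsum]; abel
  have e3 : P.root α = P.root β' + P.root γ' := by rw [hβ, e1]; abel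
  have s1 := hx.coeff_mul_coeff_neg h0 hs (e1.trans (add_comm _ _)) hβ
  have s2 := hx.coeff_mul_coeff_neg h0 hs e2 hγ
  rw [hx.coeff_swap h0 e3] at s2
  rw [hx.coeff_swap h0 e1] at s1
  have h1 : hx.coeff β' γ' ≠ 0 := hx.coeff_ne_zero e3
  refine mul_right_cancel₀ h1 ?_
  linear_combination s2 - s1

include hx in
theorem h_add {α β γ : ι} (hγ : P.root γ = P.root α + P.root β) : h γ = h α + h β := by
  obtain ⟨γ', hγ'⟩ : ∃ γ', P.root γ' = -P.root γ := exists_root_eq_neg P γ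
  obtain ⟨α', hα⟩ : ∃ α', P.root α' = -P.root α := exists_root_eq_neg P α
  obtain ⟨β', hβ⟩ : ∃ β', P.root β' = -P.root β := exists_root_eq_neg P β
  have c1 : hx.coeff α β = hx.coeff γ' α := hx.coeff_cyclic h0 hs (by rw [hγ', hγ]; abel)
  have c2 : hx.coeff γ' α = hx.coeff β γ' := hx.coeff_cyclic h0 hs (by rw [hγ', hγ]; abel)
  have e1 : P.root α' = P.root β + P.root γ' := by rw [hα, hγ', hγ]; abel
  have e2 : P.root β' = P.root γ' + P.root α := by rw [hβ, hγ', hγ]; abel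
  have key : hx.coeff α β • h γ = hx.coeff α β • (h α + h β) := by
    rw [← hx.lie_x_self_neg hγ', ← smul_lie, ← hx.lie_eq_coeff_smul hγ, lie_lie,
      hx.lie_eq_coeff_smul e1, ← lie_skew (x α) (x γ'), hx.lie_eq_coeff_smul e2, lie_smul, lie_neg,
      lie_smul, hx.lie_x_self_neg hα, hx.lie_x_self_neg hβ, ← c2, ← c1, sub_neg_eq_add, smul_add]
  exact smul_right_injective L (hx.coeff_ne_zero hγ) key

theorem coeff_square {i j θ η μ δ : ι} (hij : P.pairingIn ℤ i j = 0)
    (hη : P.root η = P.root j + P.root θ) (hμ : P.root μ = P.root i + P.root θ)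
    (hδ : P.root δ = P.root i + P.root η) :
    hx.coeff j θ * hx.coeff i η = hx.coeff i θ * hx.coeff j μ := by
  have hδ' : P.root δ = P.root j + P.root μ := by rw [hδ, hη, hμ]; abel
  have hcomm : ⁅x i, x j⁆ = 0 := by
    refine hx.lie_x_x_eq_zero i j (fun h2 => ?_) ?_
    · have := pairingIn_neg_left (eq_neg_of_add_eq_zero_left h2) j
      rw [hij, P.pairingIn_same] at this
      omega
    · rintro ⟨ε, hε⟩
      have := pairingIn_eq_neg_one_of_root_eq_add hs hε
      omega
  have h1 : ⁅x i, ⁅x j, x θ⁆⁆ = ⁅x j, ⁅x i, x θ⁆⁆ := by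
    rw [leibniz_lie, hcomm, zero_lie, zero_add]
  rw [hx.lie_eq_coeff_smul hη, hx.lie_eq_coeff_smul hμ, lie_smul, lie_smul,
    hx.lie_eq_coeff_smul hδ, hx.lie_eq_coeff_smul hδ', smul_smul, smul_smul] at h1
  exact smul_left_injective F (h0 δ) h1

end IsChevalleySpanningSet

end StructureConstants

section Comparison

variable {ι M N : Type*} [AddCommGroup M] [Module ℝ M] [AddCommGroup N] [Module ℝ N]
  {P : RootPairing ι ℝ M N} [P.IsCrystallographic]
  {F K L : Type*} [Field F] [LieRing K] [LieAlgebra F K] [LieRing L] [LieAlgebra F L]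
  {X H : ι → K} {x h : ι → L}

namespace IsChevalleySpanningSet

/-- Rescaling factors matching the structure constants of two Chevalley spanning sets, for the
products of a simple root element with positive root elements, up to a given height. -/
theorem exists_scaling_of_height_le [Finite ι] [P.IsRootSystem] [P.IsReduced] (b : P.Base)
    (hs : ∀ α β, P.pairingIn ℤ α β = P.pairingIn ℤ β α)
    (hX : IsChevalleySpanningSet P F X H) (hX0 : ∀ α, X α ≠ 0)
    (hx : IsChevalleySpanningSet P F x h) (hx0 : ∀ α, x α ≠ 0) (n : ℕ) :
    ∃ c : ι → F, (∀ α, c α ≠ 0) ∧ ∀ i ∈ b.support, ∀ η γ, b.IsPos η →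
      P.root γ = P.root i + P.root η → b.height γ ≤ n →
        hX.coeff i η * c γ = c i * c η * hx.coeff i η := by
  classical
  induction n with
  | zero =>
    refine ⟨fun _ => 1, fun _ => one_ne_zero, fun i hi η γ hη hγ hn => ?_⟩
    have h1 := (RootPairing.Base.isPos_of_mem_support hi).add hη hγ
    rw [b.isPos_iff] at h1
    norm_num at hn
    omega
  | succ n ih =>
    obtain ⟨c, hc0, hc⟩ := ih
    let Q : ι → ι × ι → Prop := fun γ q => q.1 ∈ b.support ∧ b.IsPos q.2 ∧
      P.root γ = P.root q.1 + P.root q.2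
    let r : ι × ι → F := fun q => c q.1 * c q.2 * hx.coeff q.1 q.2 / hX.coeff q.1 q.2
    let c' : ι → F := fun γ => if hq : b.height γ = n + 1 ∧ ∃ q, Q γ q then r hq.2.choose else c γ
    have hc'_lt : ∀ γ, b.height γ ≤ n → c' γ = c γ := by
      intro γ hγ
      exact dif_neg fun hq => by omega
    have hind : ∀ γ q q', b.height γ = n + 1 → Q γ q → Q γ q' → r q = r q' := by
      rintro γ ⟨i, η⟩ ⟨j, η'⟩ hγ ⟨hi, hη, hiη⟩ ⟨hj, hη', hjη'⟩
      dsimp only at hi hη hiη hj hη' hjη'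
      simp only [r]
      have kη := hX.coeff_ne_zero hiη
      have kη' := hX.coeff_ne_zero hjη'
      rw [div_eq_div_iff kη kη']
      rcases eq_or_ne i j with rfl | hij
      · have : η = η' := P.root.injective (add_left_cancel (hiη.symm.trans hjη'))
        rw [this]
      have p1 := pairingIn_eq_neg_one_of_root_eq_add hs hiη
      have p2 := pairingIn_eq_neg_one_of_root_eq_add hs hjη'
      have p3 := pairingIn_add_left hiη j
      have p4 := pairingIn_add_left hjη' j
      rw [P.pairingIn_same, hs η' j, p2] at p4
      have p5 := b.pairingIn_le_zero_of_ne hij hi hj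
      have p6 := (abs_pairingIn_le_two hs η j).2
      rcases (by omega : P.pairingIn ℤ η j = 2 ∨ P.pairingIn ℤ η j = 1) with p7 | p7
      · have e1 : η = j := (pairingIn_eq_two_iff hs).1 p7
        subst e1
        have e2 : η' = i := P.root.injective <| by
          rw [hiη, add_comm] at hjη'
          exact (add_left_cancel hjη').symm
        subst e2
        rw [hX.coeff_swap hX0 hiη, hx.coeff_swap hx0 hiη]
        ring
      · have hηj : η ≠ j := fun e => by rw [e, P.pairingIn_same] at p7; omega
        obtain ⟨θ, hθ⟩ := P.root_sub_root_mem_of_pairingIn_pos (by omega : 0 < P.pairingIn ℤ η j) hηj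
        have e1 : P.root η = P.root j + P.root θ := by rw [hθ]; abel
        have e2 : P.root η' = P.root i + P.root θ := by
          rw [← add_right_inj (P.root j), ← hjη', hiη, hθ]; abel
        have hθpos : b.IsPos θ := hη.sub hj hθ
        have g1 := b.height_add hiη
        have g2 := b.height_add hjη'
        rw [RootPairing.Base.height_one_of_mem_support hi] at g1
        rw [RootPairing.Base.height_one_of_mem_support hj] at g2
        have c1 := hc j hj θ η hθpos e1 (by omega)
        have c2 := hc i hi θ η' hθpos e2 (by omega)
        have s1 := hX.coeff_square hX0 hs (by omega) e1 e2 hiη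
        have s2 := hx.coeff_square hx0 hs (by omega) e1 e2 hiη
        have n1 := hX.coeff_ne_zero e1
        have n2 := hX.coeff_ne_zero e2
        refine mul_right_cancel₀ (mul_ne_zero n1 n2) ?_
        linear_combination (c i * hx.coeff i η * hX.coeff j η' * hX.coeff i θ) * c1 -
          (c j * hx.coeff j η' * hX.coeff i η * hX.coeff j θ) * c2 +
          (c i * c j * c θ * hX.coeff j η' * hX.coeff i θ) * s2 -
          (c i * c j * c θ * hx.coeff j η' * hx.coeff i θ) * s1
    refine ⟨c', fun γ => ?_, fun i hi η γ hη hγ hn => ?_⟩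
    · by_cases hq : b.height γ = n + 1 ∧ ∃ q, Q γ q
      · have h1 := hq.2.choose_spec.2.2
        have : c' γ = r hq.2.choose := dif_pos hq
        rw [this]
        exact div_ne_zero (mul_ne_zero (mul_ne_zero (hc0 _) (hc0 _)) (hx.coeff_ne_zero h1))
          (hX.coeff_ne_zero h1)
      · have : c' γ = c γ := dif_neg hq
        rw [this]
        exact hc0 γ
    · have g1 := b.height_add hγ
      have g2 := RootPairing.Base.height_one_of_mem_support hi
      have g3 := b.isPos_iff.1 hη
      push_cast at hn
      rw [hc'_lt i (by omega), hc'_lt η (by omega)]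
      rcases (by omega : b.height γ ≤ n ∨ b.height γ = n + 1) with g4 | g4
      · rw [hc'_lt γ g4]
        exact hc i hi η γ hη hγ g4
      · have hQ : Q γ (i, η) := ⟨hi, hη, hγ⟩
        have hq : b.height γ = n + 1 ∧ ∃ q, Q γ q := ⟨g4, _, hQ⟩
        have : c' γ = r hq.2.choose := dif_pos hq
        rw [this, hind γ _ (i, η) g4 hq.2.choose_spec hQ]
        exact mul_div_cancel₀ _ (hX.coeff_ne_zero hγ)

/-- Rescaling factors matching the structure constants of two Chevalley spanning sets, for all
products with the root elements of simple roots and their negatives. -/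
theorem exists_scaling [Finite ι] [P.IsRootSystem] [P.IsReduced] (b : P.Base)
    (hs : ∀ α β, P.pairingIn ℤ α β = P.pairingIn ℤ β α)
    (hX : IsChevalleySpanningSet P F X H) (hX0 : ∀ α, X α ≠ 0)
    (hx : IsChevalleySpanningSet P F x h) (hx0 : ∀ α, x α ≠ 0) :
    ∃ c : ι → F, (∀ α, c α ≠ 0) ∧ (∀ α α', P.root α' = -P.root α → c α * c α' = 1) ∧
      ∀ i ∈ b.support, ∀ α, P.root α = P.root i ∨ P.root α = -P.root i → ∀ β γ,
        P.root γ = P.root α + P.root β →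
          hX.coeff α β * c γ = c α * c β * hx.coeff α β := by
  classical
  have hbdd : ∃ n : ℕ, ∀ γ, b.height γ ≤ n := by
    obtain ⟨m, hm⟩ := (Set.finite_range b.height).bddAbove
    exact ⟨m.toNat, fun γ => (hm ⟨γ, rfl⟩).trans (Int.self_le_toNat m)⟩
  obtain ⟨n, hn⟩ := hbdd
  obtain ⟨c, hc0, hc⟩ := exists_scaling_of_height_le b hs hX hX0 hx hx0 n
  let ν : ι → ι := fun α => P.reflectionPerm α α
  have hν : ∀ α, P.root (ν α) = -P.root α := fun α => by simp [ν]
  let d : ι → F := fun α => if b.IsPos α then c α else (c (ν α))⁻¹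
  have hpos_neg : ∀ α α', P.root α' = -P.root α → (b.IsPos α' ↔ ¬ b.IsPos α) := by
    intro α α' hα
    have : α' = ν α := P.root.injective (hα.trans (hν α).symm)
    rw [this]
    exact RootPairing.Base.IsPos.neg_iff_not b α
  have hd_pos : ∀ α, b.IsPos α → d α = c α := fun α hα => if_pos hα
  have hd_neg : ∀ α α', P.root α' = -P.root α → b.IsPos α → d α' = (c α)⁻¹ := by
    intro α α' hα h
    have h1 : ¬ b.IsPos α' := by rw [hpos_neg α α' hα, not_not]; exact h
    have h2 : ν α' = α := P.root.injective (by rw [hν, hα, neg_neg])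
    simp only [d, if_neg h1, h2]
  have hd0 : ∀ α, d α ≠ 0 := by
    intro α
    simp only [d]
    split_ifs
    · exact hc0 α
    · exact inv_ne_zero (hc0 _)
  have hd_mul : ∀ α α', P.root α' = -P.root α → d α * d α' = 1 := by
    intro α α' hα
    by_cases h : b.IsPos α
    · rw [hd_pos α h, hd_neg α α' hα h, mul_inv_cancel₀ (hc0 α)]
    · have h1 := (hpos_neg α α' hα).2 h
      rw [hd_pos α' h1, hd_neg α' α (by rw [hα, neg_neg]) h1, inv_mul_cancel₀ (hc0 α')]
  have hsimple : ∀ i ∈ b.support, ∀ β γ, P.root γ = P.root i + P.root β →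
      hX.coeff i β * d γ = d i * d β * hx.coeff i β := by
    intro i hi β γ hγ
    have hipos := RootPairing.Base.isPos_of_mem_support hi
    by_cases hβ : b.IsPos β
    · rw [hd_pos γ (hipos.add hβ hγ), hd_pos i hipos, hd_pos β hβ]
      exact hc i hi β γ hβ hγ (hn γ)
    · obtain ⟨δ, hδ⟩ := exists_root_eq_neg P β
      obtain ⟨η, hη⟩ := exists_root_eq_neg P γ
      have hδpos := (hpos_neg β δ hδ).2 hβ
      have hηpos : b.IsPos η := hδpos.sub hi (by rw [hη, hδ, hγ]; abel)
      have e1 : P.root δ = P.root i + P.root η := by rw [hη, hδ, hγ]; abel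
      have e2 : P.root i + P.root β + P.root η = 0 := by rw [hη, hγ]; abel
      rw [hd_neg η γ (by rw [hη, neg_neg]) hηpos, hd_neg δ β (by rw [hδ, neg_neg]) hδpos,
        hd_pos i hipos]
      have s1 := hc i hi η δ hηpos e1 (hn δ)
      have k1 := hX.coeff_cyclic hX0 hs e2
      have k2 := hx.coeff_cyclic hx0 hs e2
      rw [hX.coeff_swap hX0 e1] at k1
      rw [hx.coeff_swap hx0 e1] at k2
      rw [k1, k2]
      have n1 := hc0 η
      have n2 := hc0 δ
      field_simp
      linear_combination -s1
  refine ⟨d, hd0, hd_mul, fun i hi α hα β γ hγ => ?_⟩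
  rcases hα with hα | hα
  · rw [P.root.injective hα] at hγ ⊢
    exact hsimple i hi β γ hγ
  · have e1 : P.root β = P.root i + P.root γ := by rw [hγ, hα]; abel
    have s1 := hsimple i hi γ β e1
    have k1 := hX.coeff_mul_coeff_neg hX0 hs e1 hα
    have k2 := hx.coeff_mul_coeff_neg hx0 hs e1 hα
    have s2 := hd_mul i α hα
    have n1 := hX.coeff_ne_zero e1
    have n2 := hx.coeff_ne_zero e1
    refine mul_left_cancel₀ (mul_ne_zero (mul_ne_zero n1 n2) (hd0 i)) ?_
    linear_combination (d i * d γ * hx.coeff i γ) * k1 - (d i * d α * d β * hX.coeff i γ) * k2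
      - s1 - (hX.coeff i γ * d β) * s2

end IsChevalleySpanningSet

end Comparison

section Comparison

variable {ι M N : Type*} [AddCommGroup M] [Module ℝ M] [AddCommGroup N] [Module ℝ N]
  {P : RootPairing ι ℝ M N} [P.IsCrystallographic]
  {F K L : Type*} [Field F] [LieRing K] [LieAlgebra F K] [LieRing L] [LieAlgebra F L]
  {X H : ι → K} {x h : ι → L}

namespace IsChevalleySpanningSet

/-- The root elements of simple roots and their negatives generate. -/
theorem lieSubalgebra_eq_top [Finite ι] [P.IsRootSystem] (b : P.Base)
    (hX : IsChevalleySpanningSet P F X H) (S : LieSubalgebra F K)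
    (hS : ∀ i ∈ b.support, ∀ α, P.root α = P.root i ∨ P.root α = -P.root i → X α ∈ S) :
    S = ⊤ := by
  have hmem : ∀ γ, b.IsPos γ → X γ ∈ S ∧ ∀ γ', P.root γ' = -P.root γ → X γ' ∈ S := by
    intro γ hγ
    refine hγ.induction_on_add (p := fun γ => X γ ∈ S ∧ ∀ γ', P.root γ' = -P.root γ → X γ' ∈ S)
      (fun i hi => ⟨hS i hi i (Or.inl rfl), fun α hα => hS i hi α (Or.inr hα)⟩) ?_
    · intro i j k hk hi hj
      constructor
      · rw [← LieSubalgebra.mem_toSubmodule, ← Submodule.smul_mem_iff S.toSubmodule (hX.coeff_ne_zero hk),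
          ← hX.lie_eq_coeff_smul hk]
        exact S.lie_mem hi.1 (hS j hj j (Or.inl rfl))
      · intro k' hk'
        obtain ⟨i', hi'⟩ := exists_root_eq_neg P i
        obtain ⟨j', hj'⟩ := exists_root_eq_neg P j
        have e : P.root k' = P.root i' + P.root j' := by rw [hk', hi', hj', hk]; abel
        rw [← LieSubalgebra.mem_toSubmodule, ← Submodule.smul_mem_iff S.toSubmodule (hX.coeff_ne_zero e),
          ← hX.lie_eq_coeff_smul e]
        exact S.lie_mem (hi.2 i' hi') (hS j hj j' (Or.inr hj'))
  have hXmem : ∀ γ, X γ ∈ S := by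
    intro γ
    rcases RootPairing.Base.IsPos.or_neg b γ with h1 | h1
    · exact (hmem γ h1).1
    · exact (hmem _ h1).2 γ (by simp)
  rw [← LieSubalgebra.toSubmodule_inj, LieSubalgebra.top_toSubmodule, eq_top_iff,
    ← hX.span_eq_top, Submodule.span_le]
  rintro _ (⟨α, rfl⟩ | ⟨α, rfl⟩)
  · exact hXmem α
  · obtain ⟨α', hα⟩ := exists_root_eq_neg P α
    rw [← hX.lie_x_self_neg hα]
    exact S.lie_mem (hXmem α) (hXmem α')

/-- A Lie algebra with a Chevalley basis surjects onto every Lie algebra with a Chevalley spanning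
set consisting of nonzero root elements. -/
theorem exists_surjective_lieHom [Finite ι] [P.IsRootSystem] [P.IsReduced] (b : P.Base)
    (hs : ∀ α β, P.pairingIn ℤ α β = P.pairingIn ℤ β α)
    (hX : IsChevalleySpanningSet P F X H)
    (hli : LinearIndependent F (Sum.elim X fun i : b.support => H i))
    (hspan : Submodule.span F (Set.range X ∪ H '' b.support) = ⊤)
    (hx : IsChevalleySpanningSet P F x h) (hx0 : ∀ α, x α ≠ 0) :
    ∃ φ : K →ₗ⁅F⁆ L, Function.Surjective φ := by
  have hX0 : ∀ α, X α ≠ 0 := fun α => hli.ne_zero (Sum.inl α)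
  obtain ⟨c, hc0, hcinv, hc⟩ := exists_scaling b hs hX hX0 hx hx0
  let B : Module.Basis (ι ⊕ b.support) F K := Module.Basis.mk hli <| by
    rw [Set.Sum.elim_range, ← hspan, Set.image_eq_range]
    rfl
  let φ : K →ₗ[F] L := B.constr F (Sum.elim (fun α => c α • x α) fun i => h i)
  have hφX : ∀ α, φ (X α) = c α • x α := by
    intro α
    have : X α = B (Sum.inl α) := by simp [B]
    rw [this, Module.Basis.constr_basis]
    rfl
  have hφH : ∀ α, φ (H α) = h α := by
    intro α
    induction α using b.induction_add with
    | h₀ i hi =>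
      have e : P.root (P.reflectionPerm i i) = -P.root i := by simp
      rw [hX.h_neg e, hx.h_neg e, map_neg, hi]
    | h₁ i hi =>
      have : H i = B (Sum.inr ⟨i, hi⟩) := by simp [B]
      rw [this, Module.Basis.constr_basis]
      rfl
    | h₂ i j k hk hi hj =>
      have : φ (H j) = h j := by
        have : H j = B (Sum.inr ⟨j, hj⟩) := by simp [B]
        rw [this, Module.Basis.constr_basis]
        rfl
      rw [hX.h_add hX0 hs hk, hx.h_add hx0 hs hk, map_add, hi, this]
  let S : LieSubalgebra F K :=
    { carrier := {z | ∀ w, φ ⁅z, w⁆ = ⁅φ z, φ w⁆}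
      add_mem' := fun {z z'} hz hz' w => by rw [add_lie, map_add, map_add, add_lie, hz, hz']
      zero_mem' := fun w => by simp
      smul_mem' := fun a z hz w => by rw [smul_lie, map_smul, map_smul, smul_lie, hz]
      lie_mem' := fun {z z'} hz hz' w => by
        rw [lie_lie, map_sub, hz, hz', hz', hz, hz, lie_lie] }
  have hStop : S = ⊤ := by
    refine hX.lieSubalgebra_eq_top b S fun i hi α hα w => ?_
    have hw : w ∈ Submodule.span F (Set.range X ∪ Set.range H) := by
      rw [hX.span_eq_top]; trivial
    induction hw using Submodule.span_induction with
    | mem w hw =>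
      rcases hw with ⟨β, rfl⟩ | ⟨β, rfl⟩
      · rw [hφX, hφX, smul_lie, lie_smul, smul_smul]
        by_cases e1 : P.root α + P.root β = 0
        · rw [hX.lie_x_neg α β e1, hφH, hx.lie_x_neg α β e1,
            hcinv α β (eq_neg_of_add_eq_zero_right e1), one_smul]
        · by_cases e2 : P.root α + P.root β ∈ Set.range P.root
          · obtain ⟨γ, hγ⟩ := e2
            rw [hX.lie_eq_coeff_smul hγ, map_smul, hφX, hx.lie_eq_coeff_smul hγ, smul_smul,
              smul_smul, hc i hi α hα β γ hγ]
          · rw [hX.lie_x_x_eq_zero α β e1 e2, hx.lie_x_x_eq_zero α β e1 e2, map_zero, smul_zero]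
      · rw [hφX, hφH, ← lie_skew, hX.lie_h_x, ← lie_skew, lie_smul, hx.lie_h_x, map_neg, map_smul,
          hφX, smul_comm]
    | zero => simp
    | add w w' _ _ h1 h2 => rw [lie_add, map_add, map_add, lie_add, h1, h2]
    | smul a w _ h1 => rw [lie_smul, map_smul, map_smul, lie_smul, h1]
  have hmap : ∀ z w, φ ⁅z, w⁆ = ⁅φ z, φ w⁆ := fun z w => by
    have : z ∈ S := by rw [hStop]; exact LieSubalgebra.mem_top z
    exact this w
  refine ⟨{ φ with map_lie' := fun {z w} => hmap z w }, ?_⟩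
  change Function.Surjective φ
  rw [← LinearMap.range_eq_top, eq_top_iff, ← hx.span_eq_top, Submodule.span_le]
  rintro _ (⟨α, rfl⟩ | ⟨α, rfl⟩)
  · exact ⟨(c α)⁻¹ • X α, by rw [map_smul, hφX, inv_smul_smul₀ (hc0 α)]⟩
  · exact ⟨H α, hφH α⟩

/-- Root elements of a Chevalley spanning set of a nonzero Lie algebra can be chosen nonzero. -/
theorem exists_forall_ne_zero [Finite ι] [P.IsRootSystem] [P.IsReduced] [P.IsIrreducible]
    (hs : ∀ α β, P.pairingIn ℤ α β = P.pairingIn ℤ β α) [Nontrivial L]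
    (hx : IsChevalleySpanningSet P F x h) :
    ∃ x' h' : ι → L, IsChevalleySpanningSet P F x' h' ∧ ∀ α, x' α ≠ 0 := by
  by_cases h0 : ∀ α, x α ≠ 0
  · exact ⟨x, h, hx, h0⟩
  push Not at h0
  obtain ⟨α, hα⟩ := h0
  have hh : ∀ α, x α = 0 → h α = 0 := by
    intro α hα
    obtain ⟨α', hα'⟩ := exists_root_eq_neg P α
    rw [← hx.lie_x_self_neg hα', hα, zero_lie]
  have hodd : ∀ α β, x α = 0 → (P.pairingIn ℤ α β = 1 ∨ P.pairingIn ℤ α β = -1) → x β = 0 := by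
    intro α β hα hαβ
    have h1 := hx.lie_h_x α β
    rw [hh α hα, zero_lie] at h1
    rcases hαβ with h2 | h2 <;> rw [h2] at h1 <;> simpa using h1.symm
  by_cases hrank : ∀ α, ∃ δ, P.pairingIn ℤ α δ = 1 ∨ P.pairingIn ℤ α δ = -1
  · exfalso
    have hall : ∀ β, x β = 0 := by
      refine mem_of_forall_pairingIn_ne_zero (P := P) {β | x β = 0} ⟨α, hα⟩ fun β hβ γ hγ => ?_
      have h1 := abs_pairingIn_le_two hs β γ
      by_cases h2 : P.pairingIn ℤ β γ = 1 ∨ P.pairingIn ℤ β γ = -1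
      · exact hodd β γ hβ h2
      · rcases (by omega : P.pairingIn ℤ β γ = 2 ∨ P.pairingIn ℤ β γ = -2) with h3 | h3
        · rw [← (pairingIn_eq_two_iff hs).1 h3]
          exact hβ
        · obtain ⟨δ, hδ⟩ := hrank β
          have h4 := pairingIn_neg_left ((pairingIn_eq_neg_two_iff hs).1 h3) δ
          refine hodd δ γ (hodd β δ hβ hδ) ?_
          rw [hs δ γ]
          omega
    have : (⊥ : Submodule F L) = ⊤ := by
      rw [← hx.span_eq_top, eq_comm, Submodule.span_eq_bot]
      rintro _ (⟨β, rfl⟩ | ⟨β, rfl⟩)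
      · exact hall β
      · exact hh β (hall β)
    exact bot_ne_top this
  · push Not at hrank
    obtain ⟨ω, hω⟩ := hrank
    have hroots : ∀ β, β = ω ∨ P.root β = -P.root ω := by
      refine mem_of_forall_pairingIn_ne_zero (P := P) {β | β = ω ∨ P.root β = -P.root ω} ⟨ω, Or.inl rfl⟩
        fun β hβ γ hγ => ?_
      have h1 : P.pairingIn ℤ ω γ ≠ 0 := by
        rcases hβ with rfl | hβ
        · exact hγ
        · rw [pairingIn_neg_left hβ] at hγ
          omega
      have h2 := abs_pairingIn_le_two hs ω γ
      have h3 := hω γ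
      rcases (by omega : P.pairingIn ℤ ω γ = 2 ∨ P.pairingIn ℤ ω γ = -2) with h4 | h4
      · exact Or.inl ((pairingIn_eq_two_iff hs).1 h4).symm
      · right
        rw [hs] at h4
        exact (pairingIn_eq_neg_two_iff hs).1 h4
    have htwo : ∀ β γ, β = γ ∨ P.root β = -P.root γ := by
      intro β γ
      rcases hroots β with rfl | h1 <;> rcases hroots γ with rfl | h2
      · exact Or.inl rfl
      · exact Or.inr (by rw [h2, neg_neg])
      · exact Or.inr h1
      · exact Or.inl (P.root.injective (h1.trans h2.symm))
    obtain ⟨α', hα'⟩ := exists_root_eq_neg P α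
    have hcases : ∀ β, β = α ∨ β = α' := fun β => (htwo β α).imp id fun h1 =>
      P.root.injective (h1.trans hα'.symm)
    have hhz : ∀ β, h β = 0 := by
      intro β
      rcases hcases β with rfl | rfl
      · exact hh _ hα
      · rw [hx.h_neg hα', hh α hα, neg_zero]
    have hspan : Submodule.span F {x α'} = ⊤ := by
      rw [eq_top_iff, ← hx.span_eq_top, Submodule.span_le]
      rintro _ (⟨β, rfl⟩ | ⟨β, rfl⟩)
      · rcases hcases β with rfl | rfl
        · rw [hα]; exact Submodule.zero_mem _
        · exact Submodule.mem_span_singleton_self _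
      · rw [hhz]; exact Submodule.zero_mem _
    have hv : x α' ≠ 0 := by
      intro h1
      rw [h1, Submodule.span_zero_singleton] at hspan
      exact bot_ne_top hspan
    have hchar : (2 : F) = 0 := by
      have h1 := hx.lie_h_x α' α'
      rw [hhz, zero_lie, P.pairingIn_same] at h1
      simpa [hv] using h1.symm
    refine ⟨fun _ => x α', fun _ => 0, ⟨?_, ?_, ?_, ?_, ?_, ?_⟩, fun _ => hv⟩
    · rw [eq_top_iff, ← hspan]
      refine Submodule.span_mono ?_
      rintro _ rfl
      exact Or.inl ⟨α, rfl⟩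
    · simp
    · intro β γ
      have h1 : ((P.pairingIn ℤ β γ : ℤ) : F) = 0 := by
        rcases htwo β γ with rfl | h2
        · rw [P.pairingIn_same]; exact_mod_cast hchar
        · rw [(pairingIn_eq_neg_two_iff hs).2 h2]
          push_cast
          rw [hchar, neg_zero]
      rw [h1, zero_lie, zero_smul]
    · simp
    · intro β γ δ hδ
      exfalso
      have h1 := pairingIn_eq_neg_one_of_root_eq_add hs hδ.symm
      rcases htwo β γ with rfl | h2
      · rw [P.pairingIn_same] at h1; omega
      · rw [(pairingIn_eq_neg_two_iff hs).2 h2] at h1; omega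
    · simp

end IsChevalleySpanningSet

end Comparison

section Construction

variable {ι M N : Type*} [AddCommGroup M] [Module ℝ M] [AddCommGroup N] [Module ℝ N]
  {P : RootPairing ι ℝ M N} [P.IsCrystallographic]

/-- A bimultiplicative sign on the roots of a simply-laced root system, whose commutator is the
parity of the Cartan integer. -/
structure IsSignForm (P : RootPairing ι ℝ M N) [P.IsCrystallographic] (ε : ι → ι → ℂ) : Prop where
  eq_or (α β : ι) : ε α β = 1 ∨ ε α β = -1
  add_left {α β γ : ι} (h : P.root γ = P.root α + P.root β) (δ : ι) : ε γ δ = ε α δ * ε β δ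
  add_right {α β γ : ι} (h : P.root γ = P.root α + P.root β) (δ : ι) : ε δ γ = ε δ α * ε δ β
  neg_left {α β : ι} (h : P.root β = -P.root α) (δ : ι) : ε β δ = ε α δ
  neg_right {α β : ι} (h : P.root β = -P.root α) (δ : ι) : ε δ β = ε δ α
  swap_of_eq_zero {α β : ι} (h : P.pairingIn ℤ α β = 0) : ε β α = ε α β
  swap_of_eq_neg_one {α β : ι} (h : P.pairingIn ℤ α β = -1) : ε β α = -ε α β
  self (α : ι) : ε α α = -1

theorem IsSignForm.mul_self {ε : ι → ι → ℂ} (hε : IsSignForm P ε) (α β : ι) :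
    ε α β * ε α β = 1 := by
  rcases hε.eq_or α β with h | h <;> rw [h] <;> norm_num

theorem exists_isSignForm [Finite ι] [P.IsRootSystem] (b : P.Base)
    (hs : ∀ α β, P.pairingIn ℤ α β = P.pairingIn ℤ β α) :
    ∃ ε : ι → ι → ℂ, IsSignForm P ε := by
  obtain ⟨ε, h1, h2, h3, h4, h5, h6⟩ := exists_sign_form b hs
  refine ⟨fun α β => ((ε α β : ℤ) : ℂ), ⟨?_, ?_, ?_, ?_, ?_, ?_, ?_, ?_⟩⟩
  · intro α β
    rcases Int.units_eq_one_or (ε α β) with h | h <;> simp [h]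
  · intro α β γ h δ
    rw [h1 α β γ δ h]; push_cast; rfl
  · intro α β γ h δ
    rw [h2 α β γ δ h]; push_cast; rfl
  · intro α β h δ
    rw [h3 α β δ h]
  · intro α β h δ
    rw [h4 α β δ h]
  · intro α β h
    have := h5 α β
    rw [h] at this
    rcases Int.units_eq_one_or (ε α β) with h | h <;>
      rcases Int.units_eq_one_or (ε β α) with h' | h' <;> simp [h, h'] at this ⊢
  · intro α β h
    have := h5 α β
    rw [h] at this
    rcases Int.units_eq_one_or (ε α β) with h | h <;>
      rcases Int.units_eq_one_or (ε β α) with h' | h' <;> simp [h, h'] at this ⊢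
  · intro α
    simp [h6 α]

/-- The underlying space of the Lie algebra: one basis vector for each root and for each simple
root. -/
def Carrier (b : P.Base) : Type _ := (ι ⊕ b.support) →₀ ℂ

namespace Carrier

variable (b : P.Base)

noncomputable instance : AddCommGroup (Carrier b) :=
  inferInstanceAs (AddCommGroup ((ι ⊕ b.support) →₀ ℂ))

noncomputable instance : Module ℂ (Carrier b) :=
  inferInstanceAs (Module ℂ ((ι ⊕ b.support) →₀ ℂ))

/-- The standard basis. -/
noncomputable def basis : Module.Basis (ι ⊕ b.support) ℂ (Carrier b) :=
  Module.Basis.ofRepr (LinearEquiv.refl ℂ ((ι ⊕ b.support) →₀ ℂ))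

/-- The root vector of a root. -/
noncomputable def e (α : ι) : Carrier b := basis b (Sum.inl α)

/-- The Cartan element of a simple root. -/
noncomputable def t (i : b.support) : Carrier b := basis b (Sum.inr i)

/-- The Cartan element of a root. -/
noncomputable def cartan (α : ι) : Carrier b :=
  ∑ i, b.toWeightBasisInt.repr (P.rootSpanMem ℤ α) i • t b i

omit [P.IsCrystallographic] in
theorem cartan_add {α β γ : ι} (h : P.root γ = P.root α + P.root β) :
    cartan b γ = cartan b α + cartan b β := by
  have : P.rootSpanMem ℤ γ = P.rootSpanMem ℤ α + P.rootSpanMem ℤ β := Subtype.ext h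
  simp only [cartan, this, map_add, Finsupp.add_apply, add_smul, Finset.sum_add_distrib]

omit [P.IsCrystallographic] in
theorem cartan_neg {α β : ι} (h : P.root β = -P.root α) : cartan b β = -cartan b α := by
  have : P.rootSpanMem ℤ β = -P.rootSpanMem ℤ α := Subtype.ext h
  simp only [cartan, this, map_neg, Finsupp.neg_apply, neg_smul, Finset.sum_neg_distrib]

omit [P.IsCrystallographic] in
theorem cartan_simple (i : b.support) : cartan b i = t b i := by
  have : P.rootSpanMem ℤ i = b.toWeightBasisInt i := Subtype.ext (by simp)
  rw [cartan, this, Module.Basis.repr_self, Finset.sum_eq_single i]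
  · simp
  · intro j _ hj
    simp [hj.symm]
  · simp

open Classical in
/-- Products of basis vectors. -/
noncomputable def bracketBasis (ε : ι → ι → ℂ) : ι ⊕ b.support → ι ⊕ b.support → Carrier b
  | Sum.inl α, Sum.inl β =>
    if P.pairingIn ℤ α β = -2 then -cartan b α
    else if P.pairingIn ℤ α β = -1 then ε α β • e b (P.reflectionPerm β α)
    else 0
  | Sum.inl β, Sum.inr i => -((P.pairingIn ℤ i β : ℤ) : ℂ) • e b β
  | Sum.inr i, Sum.inl β => ((P.pairingIn ℤ i β : ℤ) : ℂ) • e b β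
  | Sum.inr _, Sum.inr _ => 0

/-- The bilinear product. -/
noncomputable def bracket (ε : ι → ι → ℂ) : Carrier b →ₗ[ℂ] Carrier b →ₗ[ℂ] Carrier b :=
  (basis b).constr ℂ fun k => (basis b).constr ℂ (bracketBasis b ε k)

theorem bracket_basis (ε : ι → ι → ℂ) (k l : ι ⊕ b.support) :
    bracket b ε (basis b k) (basis b l) = bracketBasis b ε k l := by
  simp [bracket]

variable {ε : ι → ι → ℂ}

theorem bracket_e_e_neg {α β : ι} (h : P.pairingIn ℤ α β = -2) :
    bracket b ε (e b α) (e b β) = -cartan b α := by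
  rw [e, e, bracket_basis, bracketBasis, if_pos h]

theorem bracket_e_e_add {α β γ : ι} (h : P.pairingIn ℤ α β = -1)
    (hγ : P.root γ = P.root α + P.root β) :
    bracket b ε (e b α) (e b β) = ε α β • e b γ := by
  rw [e, e, bracket_basis, bracketBasis, if_neg (by omega), if_pos h]
  congr 2
  exact P.root.injective ((root_reflectionPerm_of_pairingIn_eq_neg_one h).trans hγ.symm)

theorem bracket_e_e_zero {α β : ι} (h1 : P.pairingIn ℤ α β ≠ -2) (h2 : P.pairingIn ℤ α β ≠ -1) :
    bracket b ε (e b α) (e b β) = 0 := by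
  rw [e, e, bracket_basis, bracketBasis, if_neg h1, if_neg h2]

theorem bracket_t_e (i : b.support) (β : ι) :
    bracket b ε (t b i) (e b β) = ((P.pairingIn ℤ i β : ℤ) : ℂ) • e b β := by
  rw [e, t, bracket_basis, bracketBasis, e]

theorem bracket_e_t (i : b.support) (β : ι) :
    bracket b ε (e b β) (t b i) = -((P.pairingIn ℤ i β : ℤ) : ℂ) • e b β := by
  rw [e, t, bracket_basis, bracketBasis, e]

theorem bracket_t_t (i j : b.support) : bracket b ε (t b i) (t b j) = 0 := by
  rw [t, t, bracket_basis, bracketBasis]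

theorem bracket_t_cartan (i : b.support) (α : ι) : bracket b ε (t b i) (cartan b α) = 0 := by
  simp [cartan, bracket_t_t]

theorem pairingIn_eq_sum (α β : ι) :
    P.pairingIn ℤ α β =
      ∑ i, b.toWeightBasisInt.repr (P.rootSpanMem ℤ α) i * P.pairingIn ℤ i β := by
  have ha_root : P.root α = ∑ i, b.toWeightBasisInt.repr (P.rootSpanMem ℤ α) i • P.root i := by
    have := congrArg Subtype.val (b.toWeightBasisInt.sum_repr (P.rootSpanMem ℤ α))
    simpa using this.symm
  apply FaithfulSMul.algebraMap_injective ℤ ℝ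
  simp only [map_sum, map_mul, P.algebraMap_pairingIn]
  rw [← RootPairing.root_coroot_eq_pairing, ha_root]
  simp

theorem bracket_cartan_e (α β : ι) :
    bracket b ε (cartan b α) (e b β) = ((P.pairingIn ℤ α β : ℤ) : ℂ) • e b β := by
  rw [pairingIn_eq_sum b α β]
  simp only [cartan, map_sum, map_zsmul, LinearMap.coe_sum, Finset.sum_apply,
    LinearMap.smul_apply, bracket_t_e, Int.cast_sum, Int.cast_mul, Finset.sum_smul, mul_smul,
    Int.cast_smul_eq_zsmul]

theorem bracket_cartan_cartan (α β : ι) : bracket b ε (cartan b α) (cartan b β) = 0 := by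
  rw [cartan]
  simp [bracket_t_cartan]

theorem bracket_e_cartan (α β : ι) :
    bracket b ε (e b β) (cartan b α) = -((P.pairingIn ℤ α β : ℤ) : ℂ) • e b β := by
  rw [pairingIn_eq_sum b α β]
  simp only [cartan, map_sum, map_zsmul, bracket_e_t, Int.cast_sum, Int.cast_mul,
    ← Finset.sum_neg_distrib, ← mul_neg, Finset.sum_smul, mul_smul, Int.cast_smul_eq_zsmul]

variable [Finite ι] [P.IsRootSystem]
variable (hs : ∀ α β, P.pairingIn ℤ α β = P.pairingIn ℤ β α) (hε : IsSignForm P ε)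

include hs hε

theorem bracket_e_e_skew (α β : ι) :
    bracket b ε (e b α) (e b β) = -bracket b ε (e b β) (e b α) := by
  by_cases h2 : P.pairingIn ℤ α β = -2
  · rw [bracket_e_e_neg b h2, bracket_e_e_neg b (by rw [hs]; exact h2),
      cartan_neg b ((pairingIn_eq_neg_two_iff hs).1 h2)]
  · by_cases h1 : P.pairingIn ℤ α β = -1
    · have h := root_reflectionPerm_of_pairingIn_eq_neg_one h1
      rw [bracket_e_e_add b h1 h, bracket_e_e_add b (by rw [hs]; exact h1)
        (h.trans (add_comm _ _)), hε.swap_of_eq_neg_one h1, neg_smul, neg_neg]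
    · rw [bracket_e_e_zero b h2 h1, bracket_e_e_zero b (by rwa [hs]) (by rwa [hs]), neg_zero]

theorem bracket_skew (v w : Carrier b) : bracket b ε v w = -bracket b ε w v := by
  have : bracket b ε = -(bracket b ε).flip := by
    refine (basis b).ext fun k => (basis b).ext fun l => ?_
    rw [LinearMap.neg_apply, LinearMap.neg_apply, LinearMap.flip_apply]
    rcases k with α | i <;> rcases l with β | j
    · exact bracket_e_e_skew b hs hε α β
    · exact (bracket_e_t b j α).trans (by rw [neg_smul]; exact congrArg _ (bracket_t_e b j α).symm)
    · exact (bracket_t_e b i β).trans (by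
        rw [← neg_neg (_ • _), ← neg_smul]; exact congrArg _ (bracket_e_t b i β).symm)
    · exact (bracket_t_t b i j).trans (by
        rw [eq_comm, neg_eq_zero]; exact bracket_t_t b j i)
  exact LinearMap.congr_fun₂ this v w

/-- The left-hand side of the Jacobi identity. -/
noncomputable def jacobiator {b : P.Base} (ε : ι → ι → ℂ) (x y z : Carrier b) : Carrier b :=
  bracket b ε x (bracket b ε y z) + bracket b ε y (bracket b ε z x) +
    bracket b ε z (bracket b ε x y)

omit hs hε [Finite ι] [P.IsRootSystem] in
theorem jacobiator_rotate {b : P.Base} (x y z : Carrier b) :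
    jacobiator ε y z x = jacobiator ε x y z := by
  simp only [jacobiator]
  abel

omit [Finite ι] [P.IsRootSystem] hε in
theorem bracket_e_bracket_neg {α β γ : ι} (h : P.pairingIn ℤ β γ = -2) :
    bracket b ε (e b α) (bracket b ε (e b β) (e b γ)) =
      ((P.pairingIn ℤ α β : ℤ) : ℂ) • e b α := by
  rw [bracket_e_e_neg b h, map_neg, bracket_e_cartan, neg_smul, neg_neg, hs]

omit [Finite ι] [P.IsRootSystem] in
theorem bracket_e_bracket_add {α β γ δ : ι} (h : P.pairingIn ℤ β γ = -1)
    (h' : P.pairingIn ℤ α β + P.pairingIn ℤ γ α = -1)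
    (hδ : P.root δ = P.root α + P.root β + P.root γ) :
    bracket b ε (e b α) (bracket b ε (e b β) (e b γ)) =
      (ε β γ * (ε α β * ε α γ)) • e b δ := by
  have h1 := root_reflectionPerm_of_pairingIn_eq_neg_one h
  have h2 := pairingIn_add_right hs h1 α
  rw [hs α γ] at h2
  rw [bracket_e_e_add b h h1, map_smul, bracket_e_e_add b (γ := δ) (h2.trans h')
    (by rw [hδ, h1]; abel), smul_smul, hε.add_right h1]

omit [Finite ι] [P.IsRootSystem] hε in
theorem bracket_e_bracket_zero {α β γ : ι} (h : P.pairingIn ℤ β γ ≠ -2)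
    (h' : P.pairingIn ℤ β γ = -1 → P.pairingIn ℤ α β + P.pairingIn ℤ γ α ≠ -1 ∧
      P.pairingIn ℤ α β + P.pairingIn ℤ γ α ≠ -2) :
    bracket b ε (e b α) (bracket b ε (e b β) (e b γ)) = 0 := by
  by_cases h0 : P.pairingIn ℤ β γ = -1
  · have h1 := root_reflectionPerm_of_pairingIn_eq_neg_one h0
    have h2 := pairingIn_add_right hs h1 α
    rw [hs α γ] at h2
    obtain ⟨h3, h4⟩ := h' h0
    rw [bracket_e_e_add b h0 h1, map_smul, bracket_e_e_zero b (by omega) (by omega), smul_zero]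
  · rw [bracket_e_e_zero b h h0, map_zero]

theorem jacobiator_e_of_neg {α β γ : ι} (h : P.pairingIn ℤ β γ = -2) :
    jacobiator ε (e b α) (e b β) (e b γ) = 0 := by
  have hγ : P.root γ = -P.root β := by
    rw [(pairingIn_eq_neg_two_iff hs).1 h, neg_neg]
  have hc := pairingIn_neg_left hγ α
  rw [hs β α] at hc
  have hbd := abs_pairingIn_le_two hs α β
  have hδ : P.root α = P.root β + P.root γ + P.root α := by rw [hγ]; abel
  rw [jacobiator, bracket_e_bracket_neg b hs h]
  rcases (by omega : P.pairingIn ℤ α β = -2 ∨ P.pairingIn ℤ α β = -1 ∨ P.pairingIn ℤ α β = 0 ∨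
    P.pairingIn ℤ α β = 1 ∨ P.pairingIn ℤ α β = 2) with ha | ha | ha | ha | ha
  · have : γ = α := (pairingIn_eq_two_iff hs).1 (by omega)
    subst this
    rw [bracket_e_bracket_zero b hs (β := γ) (γ := γ) (by simp) (by simp),
      bracket_e_bracket_neg b hs ha, ha, P.pairingIn_same, add_zero, ← add_smul]
    norm_num
  · rw [bracket_e_bracket_zero b hs (β := γ) (γ := α) (by omega) (by omega),
      bracket_e_bracket_add b hs hε (δ := α) ha (by omega) (by rw [hγ]; abel), ha,
      hε.neg_left hγ, hε.neg_left hγ, hε.self, hε.swap_of_eq_neg_one ha, add_zero, ← add_smul]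
    have := hε.mul_self α β
    have h2 : ((-1 : ℤ) : ℂ) + ε α β * (-ε α β * -1) = 0 := by push_cast; linear_combination this
    rw [h2, zero_smul]
  · rw [bracket_e_bracket_zero b hs (β := γ) (γ := α) (by omega) (by omega),
      bracket_e_bracket_zero b hs (β := α) (γ := β) (by omega) (by omega), ha]
    simp
  · rw [bracket_e_bracket_zero b hs (β := α) (γ := β) (by omega) (by omega),
      bracket_e_bracket_add b hs hε (δ := α) (by omega) (by omega) hδ, ha,
      hε.neg_left hγ, hε.neg_right hγ, hε.self, add_zero, ← add_smul]
    have := hε.mul_self β α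
    have h2 : ((1 : ℤ) : ℂ) + ε β α * (-1 * ε β α) = 0 := by push_cast; linear_combination -this
    rw [h2, zero_smul]
  · have : α = β := (pairingIn_eq_two_iff hs).1 ha
    subst this
    rw [bracket_e_bracket_neg b hs (β := γ) (γ := α) (by omega),
      bracket_e_bracket_zero b hs (β := α) (γ := α) (by simp) (by simp), h, P.pairingIn_same,
      add_zero, ← add_smul]
    norm_num

theorem jacobiator_e_of_sum_eq_zero {α β γ : ι} (ha : P.pairingIn ℤ α β = -1)
    (hb : P.pairingIn ℤ β γ = -1) (hc : P.pairingIn ℤ γ α = -1) :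
    jacobiator ε (e b α) (e b β) (e b γ) = 0 := by
  have e1 := root_reflectionPerm_of_pairingIn_eq_neg_one ha
  set μ := P.reflectionPerm β α
  have h1 := pairingIn_add_left e1 γ
  rw [hs α γ, hb, hc] at h1
  have hμ : P.root γ = -P.root μ := by rw [(pairingIn_eq_neg_two_iff hs).1 h1, neg_neg]
  have e2 : P.root (P.reflectionPerm γ β) = -P.root α := by
    rw [root_reflectionPerm_of_pairingIn_eq_neg_one hb, hμ, e1]; abel
  have e3 : P.root (P.reflectionPerm α γ) = -P.root β := by
    rw [root_reflectionPerm_of_pairingIn_eq_neg_one hc, hμ, e1]; abel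
  have term : ∀ {α β γ : ι} (hb : P.pairingIn ℤ β γ = -1)
      (h : P.root (P.reflectionPerm γ β) = -P.root α),
      bracket b ε (e b α) (bracket b ε (e b β) (e b γ)) = -(ε β γ • cartan b α) := by
    intro α β γ hb h
    rw [bracket_e_e_add b hb (root_reflectionPerm_of_pairingIn_eq_neg_one hb), map_smul,
      bracket_e_e_neg b ((pairingIn_eq_neg_two_iff hs).2 (by rw [h, neg_neg])), smul_neg]
  have k1 : ε β γ = ε α β := by
    rw [hε.neg_right hμ, hε.add_right e1, hε.self, hε.swap_of_eq_neg_one ha]; ring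
  have k2 : ε γ α = ε α β := by
    rw [hε.neg_left hμ, hε.add_left e1, hε.self, hε.swap_of_eq_neg_one ha]; ring
  rw [jacobiator, term hb e2, term hc e3, term ha (by rw [hμ, neg_neg]), k1, k2,
    cartan_neg b hμ, cartan_add b e1]
  module

omit [Finite ι] [P.IsRootSystem] in
theorem jacobiator_e_of_add {α β γ : ι} (ha : P.pairingIn ℤ α β = -1)
    (hb : P.pairingIn ℤ β γ = -1) (hc : P.pairingIn ℤ γ α = 0) :
    jacobiator ε (e b α) (e b β) (e b γ) = 0 := by
  have e1 := root_reflectionPerm_of_pairingIn_eq_neg_one ha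
  have h1 := pairingIn_add_left e1 γ
  rw [hs α γ, hb, hc] at h1
  have e2 := root_reflectionPerm_of_pairingIn_eq_neg_one h1
  rw [e1] at e2
  rw [jacobiator, bracket_e_bracket_add b hs hε hb (by omega) e2,
    bracket_e_bracket_zero b hs (β := γ) (γ := α) (by omega) (by omega),
    bracket_e_bracket_add b hs hε (α := γ) ha (by omega) (by rw [e2]; abel),
    hε.swap_of_eq_neg_one hb, hε.swap_of_eq_zero hc]
  module

theorem jacobiator_e (α β γ : ι) : jacobiator ε (e b α) (e b β) (e b γ) = 0 := by
  by_cases h1 : P.pairingIn ℤ β γ = -2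
  · exact jacobiator_e_of_neg b hs hε h1
  by_cases h2 : P.pairingIn ℤ γ α = -2
  · rw [← jacobiator_rotate]
    exact jacobiator_e_of_neg b hs hε h2
  by_cases h3 : P.pairingIn ℤ α β = -2
  · rw [← jacobiator_rotate, ← jacobiator_rotate]
    exact jacobiator_e_of_neg b hs hε h3
  have b1 := (abs_pairingIn_le_two hs β γ).1
  have b2 := (abs_pairingIn_le_two hs γ α).1
  have b3 := (abs_pairingIn_le_two hs α β).1
  by_cases h4 : P.pairingIn ℤ α β = -1 ∧ P.pairingIn ℤ β γ = -1 ∧ P.pairingIn ℤ γ α = -1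
  · exact jacobiator_e_of_sum_eq_zero b hs hε h4.1 h4.2.1 h4.2.2
  by_cases h5 : P.pairingIn ℤ α β = -1 ∧ P.pairingIn ℤ β γ = -1 ∧ P.pairingIn ℤ γ α = 0
  · exact jacobiator_e_of_add b hs hε h5.1 h5.2.1 h5.2.2
  by_cases h6 : P.pairingIn ℤ β γ = -1 ∧ P.pairingIn ℤ γ α = -1 ∧ P.pairingIn ℤ α β = 0
  · rw [← jacobiator_rotate]
    exact jacobiator_e_of_add b hs hε h6.1 h6.2.1 h6.2.2
  by_cases h7 : P.pairingIn ℤ γ α = -1 ∧ P.pairingIn ℤ α β = -1 ∧ P.pairingIn ℤ β γ = 0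
  · rw [← jacobiator_rotate, ← jacobiator_rotate]
    exact jacobiator_e_of_add b hs hε h7.1 h7.2.1 h7.2.2
  rw [jacobiator, bracket_e_bracket_zero b hs h1 (by omega),
    bracket_e_bracket_zero b hs h2 (by omega), bracket_e_bracket_zero b hs h3 (by omega)]
  simp

theorem jacobiator_t_e_e (i : b.support) (α β : ι) :
    jacobiator ε (t b i) (e b α) (e b β) = 0 := by
  rw [jacobiator, bracket_e_t, bracket_t_e, map_smul, map_smul, bracket_e_e_skew b hs hε β α]
  by_cases h2 : P.pairingIn ℤ α β = -2
  · have h3 := pairingIn_neg_right hs ((pairingIn_eq_neg_two_iff hs).1 h2) i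
    rw [bracket_e_e_neg b h2, map_neg, bracket_t_cartan, h3]
    push_cast
    module
  · by_cases h1 : P.pairingIn ℤ α β = -1
    · have h := root_reflectionPerm_of_pairingIn_eq_neg_one h1
      have h3 := pairingIn_add_right hs h i
      rw [bracket_e_e_add b h1 h, map_smul, bracket_t_e, h3]
      push_cast
      module
    · rw [bracket_e_e_zero b h2 h1]
      simp

omit hs hε [Finite ι] [P.IsRootSystem] in
theorem jacobiator_t_t_e (i j : b.support) (β : ι) :
    jacobiator ε (t b i) (t b j) (e b β) = 0 := by
  rw [jacobiator, bracket_t_t, bracket_e_t, bracket_t_e, map_smul, map_smul, bracket_t_e,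
    bracket_t_e, map_zero]
  module

omit hs hε [Finite ι] [P.IsRootSystem] in
theorem jacobiator_t_t_t (i j k : b.support) :
    jacobiator ε (t b i) (t b j) (t b k) = 0 := by
  simp [jacobiator, bracket_t_t]

theorem jacobiator_basis (k l m : ι ⊕ b.support) :
    jacobiator ε (basis b k) (basis b l) (basis b m) = 0 := by
  rcases k with α | i <;> rcases l with β | j <;> rcases m with γ | k
  · exact jacobiator_e b hs hε α β γ
  · rw [← jacobiator_rotate, ← jacobiator_rotate]
    exact jacobiator_t_e_e b hs hε k α β
  · rw [← jacobiator_rotate]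
    exact jacobiator_t_e_e b hs hε j γ α
  · rw [← jacobiator_rotate]
    exact jacobiator_t_t_e b j k α
  · exact jacobiator_t_e_e b hs hε i β γ
  · rw [← jacobiator_rotate, ← jacobiator_rotate]
    exact jacobiator_t_t_e b k i β
  · exact jacobiator_t_t_e b i j γ
  · exact jacobiator_t_t_t b i j k

theorem jacobiator_eq_zero (x y z : Carrier b) : jacobiator ε x y z = 0 := by
  have ext : ∀ x y : Carrier b, (∀ m, jacobiator ε x y (basis b m) = 0) →
      ∀ z, jacobiator ε x y z = 0 := by
    intro x y h
    have : bracket b ε x ∘ₗ bracket b ε y + bracket b ε y ∘ₗ (bracket b ε).flip x +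
        (bracket b ε).flip (bracket b ε x y) = 0 := (basis b).ext h
    exact fun z => LinearMap.congr_fun this z
  have h1 : ∀ k l z, jacobiator ε (basis b k) (basis b l) z = 0 := fun k l =>
    ext _ _ (jacobiator_basis b hs hε k l)
  have h2 : ∀ k y z, jacobiator ε z (basis b k) y = 0 := fun k y z =>
    ext _ _ (fun l => by rw [jacobiator_rotate, jacobiator_rotate, h1]) y
  exact ext _ _ (fun k => by rw [jacobiator_rotate, jacobiator_rotate, h2]) z

end Carrier

end Construction

section Simple

variable {ι M N : Type*} [AddCommGroup M] [Module ℝ M] [AddCommGroup N] [Module ℝ N]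
  {P : RootPairing ι ℝ M N} [P.IsCrystallographic]
  {g : Type*} [LieRing g] [LieAlgebra ℂ g] {x h : ι → g}

namespace IsChevalleySpanningSet

theorem lie_x_x_eq_zero_of_pairingIn [Finite ι] [P.IsRootSystem]
    (hs : ∀ α β, P.pairingIn ℤ α β = P.pairingIn ℤ β α) (hx : IsChevalleySpanningSet P ℂ x h)
    {α β : ι} (h1 : P.pairingIn ℤ α β ≠ -1) (h2 : P.pairingIn ℤ α β ≠ -2) : ⁅x α, x β⁆ = 0 := by
  refine hx.lie_x_x_eq_zero α β (fun h3 => h2 ?_) ?_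
  · exact (pairingIn_eq_neg_two_iff hs).2 (eq_neg_of_add_eq_zero_left h3)
  · rintro ⟨γ, hγ⟩
    exact h1 (pairingIn_eq_neg_one_of_root_eq_add hs hγ)

/-- A complex Lie algebra with a Chevalley spanning set, whose root elements and simple Cartan
elements form a basis, is simple. -/
theorem isSimple [Finite ι] [P.IsRootSystem] [P.IsReduced] [P.IsIrreducible] (b : P.Base)
    (hs : ∀ α β, P.pairingIn ℤ α β = P.pairingIn ℤ β α) (hx : IsChevalleySpanningSet P ℂ x h)
    (hli : LinearIndependent ℂ (Sum.elim x fun i : b.support => h i))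
    (hspan : Submodule.span ℂ (Set.range x ∪ h '' b.support) = ⊤) :
    LieAlgebra.IsSimple ℂ g := by
  classical
  let B : Module.Basis (ι ⊕ b.support) ℂ g := Module.Basis.mk hli <| by
    rw [Set.Sum.elim_range, ← hspan, Set.image_eq_range]
    rfl
  have hBx : ∀ α, B (Sum.inl α) = x α := fun α => by simp [B]
  have hBh : ∀ i : b.support, B (Sum.inr i) = h i := fun i => by simp [B]
  have hrx : ∀ α, B.repr (x α) = Finsupp.single (Sum.inl α) 1 := fun α => by
    rw [← hBx, B.repr_self]
  have hrh : ∀ i : b.support, B.repr (h i) = Finsupp.single (Sum.inr i) 1 := fun i => by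
    rw [← hBh, B.repr_self]
  have hx0 : ∀ α, x α ≠ 0 := fun α => hli.ne_zero (Sum.inl α)
  have had : ∀ α α', P.root α' = -P.root α → ∀ z,
      ⁅x α', ⁅x α', z⁆⁆ = (-2 * B.coord (Sum.inl α) z) • x α' := by
    intro α α' hα
    have : (LieAlgebra.ad ℂ g (x α')) ∘ₗ (LieAlgebra.ad ℂ g (x α')) =
        ((-2 : ℂ) • B.coord (Sum.inl α)).smulRight (x α') := by
      refine B.ext fun k => ?_
      rcases k with β | i
      · simp only [LinearMap.comp_apply, LieAlgebra.ad_apply, LinearMap.smulRight_apply,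
          LinearMap.smul_apply, Module.Basis.coord_apply, hBx, hrx]
        rcases eq_or_ne β α with rfl | hβ
        · rw [hx.lie_x_self_neg (α := α') (by rw [hα, neg_neg]), ← lie_skew, hx.lie_h_x,
            P.pairingIn_same]
          simp
        · rw [Finsupp.single_eq_of_ne (by simpa using hβ.symm), smul_zero, zero_smul]
          have h2 : P.pairingIn ℤ α' β ≠ -2 := fun h2 => hβ <| P.root.injective <| by
            rw [(pairingIn_eq_neg_two_iff hs).1 h2] at hα
            exact neg_injective hα
          by_cases h1 : P.pairingIn ℤ α' β = -1
          · have e := root_reflectionPerm_of_pairingIn_eq_neg_one h1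
            have h3 := pairingIn_add_right hs e α'
            rw [P.pairingIn_same, h1] at h3
            rw [hx.lie_eq_coeff_smul e, lie_smul,
              hx.lie_x_x_eq_zero_of_pairingIn hs (by omega) (by omega), smul_zero]
          · rw [hx.lie_x_x_eq_zero_of_pairingIn hs h1 h2, lie_zero]
      · simp only [LinearMap.comp_apply, LieAlgebra.ad_apply, LinearMap.smulRight_apply,
          LinearMap.smul_apply, Module.Basis.coord_apply, hBh, hrh]
        rw [← lie_skew (x α') (h i), hx.lie_h_x]
        simp
    intro z
    exact LinearMap.congr_fun this z
  refine ⟨fun I => ?_, fun hab => ?_⟩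
  · rw [or_iff_not_imp_left]
    intro hI
    rw [LieSubmodule.eq_bot_iff] at hI
    push Not at hI
    obtain ⟨z, hz, hz0⟩ := hI
    have hex : ∃ α, x α ∈ I := by
      by_cases hc : ∃ α, B.coord (Sum.inl α) z ≠ 0
      · obtain ⟨α, hα⟩ := hc
        obtain ⟨α', hα'⟩ := exists_root_eq_neg P α
        refine ⟨α', ?_⟩
        have h1 : ⁅x α', ⁅x α', z⁆⁆ ∈ I := I.lie_mem (I.lie_mem hz)
        rw [had α α' hα'] at h1
        exact (Submodule.smul_mem_iff I.toSubmodule (mul_ne_zero (by norm_num) hα)).1 h1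
      · push Not at hc
        have hzsum : z = ∑ i : b.support, B.coord (Sum.inr i) z • h i := by
          have := Fintype.ofFinite ι
          conv_lhs => rw [← B.sum_repr z]
          rw [Fintype.sum_sum_type]
          simp only [← Module.Basis.coord_apply, hc, zero_smul, Finset.sum_const_zero, zero_add,
            hBh]
        have hzx : ∀ β, ⁅z, x β⁆ =
            (∑ i : b.support, B.coord (Sum.inr i) z * ((P.pairingIn ℤ i β : ℤ) : ℂ)) • x β := by
          intro β
          conv_lhs => rw [hzsum]
          rw [sum_lie, Finset.sum_smul]
          exact Finset.sum_congr rfl fun i _ => by rw [smul_lie, hx.lie_h_x, smul_smul]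
        by_contra hno
        push Not at hno
        have hsum : ∀ β,
            ∑ i : b.support, B.coord (Sum.inr i) z * ((P.pairingIn ℤ i β : ℤ) : ℂ) = 0 := by
          intro β
          by_contra h1
          have h2 : ⁅z, x β⁆ ∈ I := lie_mem_left ℂ g I z (x β) hz
          rw [hzx] at h2
          exact hno β ((Submodule.smul_mem_iff I.toSubmodule h1).1 h2)
        have hdet : (b.cartanMatrix.map (Int.cast : ℤ → ℂ)).det ≠ 0 := by
          have h1 := (Matrix.nondegenerate_iff_det_ne_zero).1 b.cartanMatrix_nondegenerate
          have h2 := RingHom.map_det (Int.castRingHom ℂ) b.cartanMatrix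
          rw [RingHom.mapMatrix_apply, Int.coe_castRingHom] at h2
          rw [← h2]
          exact Int.cast_ne_zero.2 h1
        have hcoef := Matrix.eq_zero_of_vecMul_eq_zero hdet
          (v := fun i => B.coord (Sum.inr i) z) (by
            funext j
            exact hsum j)
        refine hz0 ?_
        rw [hzsum]
        exact Finset.sum_eq_zero fun i _ => by
          rw [show B.coord (Sum.inr i) z = 0 from congrFun hcoef i, zero_smul]
    have hh : ∀ α, x α ∈ I → h α ∈ I := by
      intro α hα
      obtain ⟨α', hα'⟩ := exists_root_eq_neg P α
      rw [← hx.lie_x_self_neg hα']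
      exact lie_mem_left ℂ g I _ _ hα
    have hall : ∀ α, x α ∈ I := by
      refine mem_of_forall_pairingIn_ne_zero (P := P) {α | x α ∈ I} hex fun α hα β hβ => ?_
      have h1 : ⁅h α, x β⁆ ∈ I := lie_mem_left ℂ g I _ _ (hh α hα)
      rw [hx.lie_h_x] at h1
      exact (Submodule.smul_mem_iff I.toSubmodule (by exact_mod_cast hβ)).1 h1
    rw [← LieSubmodule.toSubmodule_inj, LieSubmodule.top_toSubmodule, eq_top_iff,
      ← hx.span_eq_top, Submodule.span_le]
    rintro _ (⟨α, rfl⟩ | ⟨α, rfl⟩)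
    · exact hall α
    · exact hh α (hall α)
  · obtain ⟨α⟩ := nonempty_of_isIrreducible P
    have h1 := hx.lie_h_x α α
    rw [trivial_lie_zero, P.pairingIn_same] at h1
    exact hx0 α ((smul_eq_zero.1 h1.symm).resolve_left (by norm_num))

end IsChevalleySpanningSet

/-- Existence of a simple complex Lie algebra with a Chevalley basis. -/
theorem exists_isChevalleyBasis {ι : Type u} {M N : Type*} [Finite ι]
    [AddCommGroup M] [Module ℝ M] [AddCommGroup N] [Module ℝ N]
    (P : RootPairing ι ℝ M N) [P.IsRootSystem] [P.IsCrystallographic] [P.IsReduced]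
    [P.IsIrreducible] (b : P.Base) (hs : ∀ α β, P.pairingIn ℤ α β = P.pairingIn ℤ β α) :
    ∃ (g : Type u) (_ : LieRing g) (_ : LieAlgebra ℂ g) (x h : ι → g),
      IsChevalleyBasis b x h := by
  classical
  obtain ⟨ε, hε⟩ := exists_isSignForm b hs
  let : LieRing (Carrier b) :=
    { bracket := fun v w => Carrier.bracket b ε v w
      add_lie := fun u v w => by
        change Carrier.bracket b ε (u + v) w = _
        rw [map_add, LinearMap.add_apply]
      lie_add := fun u v w => map_add _ v w
      lie_self := fun v => by
        have h1 : Carrier.bracket b ε v v = -Carrier.bracket b ε v v :=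
          Carrier.bracket_skew b hs hε v v
        have h2 : (2 : ℂ) • Carrier.bracket b ε v v = 0 := by
          rw [two_smul]; exact add_eq_zero_iff_eq_neg.2 h1
        exact (smul_eq_zero.1 h2).resolve_left two_ne_zero
      leibniz_lie := fun u v w => by
        change Carrier.bracket b ε u (Carrier.bracket b ε v w) =
          Carrier.bracket b ε (Carrier.bracket b ε u v) w +
            Carrier.bracket b ε v (Carrier.bracket b ε u w)
        have h1 := Carrier.jacobiator_eq_zero b hs hε u v w
        rw [Carrier.jacobiator, Carrier.bracket_skew b hs hε w (Carrier.bracket b ε u v),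
          Carrier.bracket_skew b hs hε w u, map_neg, add_neg_eq_zero] at h1
        rw [← h1]
        abel }
  let : LieAlgebra ℂ (Carrier b) :=
    { lie_smul := fun c v w => (Carrier.bracket b ε v).map_smul c w }
  have hbr : ∀ v w : Carrier b, ⁅v, w⁆ = Carrier.bracket b ε v w := fun _ _ => rfl
  let s : ι → ℤˣ := fun α => if b.IsPos α then 1 else -1
  let x : ι → Carrier b := fun α => (s α : ℤ) • Carrier.e b α
  let h : ι → Carrier b := Carrier.cartan b
  have hs2 : ∀ α, s α = 1 ∨ s α = -1 := fun α => Int.units_eq_one_or _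
  have hs_neg : ∀ α β, P.root β = -P.root α → s β = -s α := by
    intro α β hβ
    have : β = P.reflectionPerm α α := P.root.injective (by simp [hβ])
    have h1 : b.IsPos (P.reflectionPerm α α) ↔ ¬ b.IsPos α :=
      RootPairing.Base.IsPos.neg_iff_not b α
    rw [this]
    simp only [s]
    by_cases h2 : b.IsPos α
    · rw [if_pos h2, if_neg (by rw [h1, not_not]; exact h2)]
    · rw [if_neg h2, if_pos (h1.2 h2), neg_neg]
  have hx_add : ∀ α β γ, P.root α + P.root β = P.root γ →
      ⁅x α, x β⁆ = x γ ∨ ⁅x α, x β⁆ = -x γ := by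
    intro α β γ hγ
    have h1 := pairingIn_eq_neg_one_of_root_eq_add hs hγ.symm
    rw [hbr]
    simp only [x, map_zsmul, LinearMap.smul_apply, Carrier.bracket_e_e_add b h1 hγ.symm]
    rcases hs2 α with e1 | e1 <;> rcases hs2 β with e2 | e2 <;> rcases hs2 γ with e3 | e3 <;>
      rcases hε.eq_or α β with e4 | e4 <;> simp [e1, e2, e3, e4]
  have hx_span : ∀ α, x α ∈ Submodule.span ℂ (Set.range x ∪ h '' b.support) := fun α =>
    Submodule.subset_span (Or.inl ⟨α, rfl⟩)
  have hspan : Submodule.span ℂ (Set.range x ∪ h '' b.support) = ⊤ := by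
    rw [eq_top_iff, ← (Carrier.basis b).span_eq, Submodule.span_le]
    rintro _ ⟨α | i, rfl⟩
    · change Carrier.e b α ∈ Submodule.span ℂ _
      have h1 := hx_span α
      rcases hs2 α with e1 | e1 <;> simpa [x, e1] using h1
    · refine Submodule.subset_span (Or.inr ⟨i, i.2, ?_⟩)
      exact Carrier.cartan_simple b i
  have hspan' : IsChevalleySpanningSet P ℂ x h := by
    refine ⟨?_, ?_, ?_, ?_, ?_, ?_⟩
    · rw [eq_top_iff, ← hspan]
      exact Submodule.span_mono (Set.union_subset_union_right _ (Set.image_subset_range _ _))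
    · exact fun α β => Carrier.bracket_cartan_cartan b α β
    · intro α β
      rw [hbr]
      simp only [x, h, map_zsmul, Carrier.bracket_cartan_e]
      rw [smul_comm]
    · intro α β hβ
      have h1 : P.root α = -P.root β := eq_neg_of_add_eq_zero_left hβ
      have h2 := hs_neg β α h1
      rw [hbr]
      simp only [x, map_zsmul, LinearMap.smul_apply,
        Carrier.bracket_e_e_neg b ((pairingIn_eq_neg_two_iff hs).2 h1), h2]
      rcases hs2 β with e1 | e1 <;> simp [e1, h]
    · intro α β γ hγ
      rcases hx_add α β γ hγ with h1 | h1
      · exact ⟨1, one_ne_zero, by rw [h1, one_smul]⟩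
      · exact ⟨-1, neg_ne_zero.2 one_ne_zero, by rw [h1, neg_smul, one_smul]⟩
    · intro α β h1 h2
      rw [hbr]
      simp only [x, map_zsmul, LinearMap.smul_apply]
      rw [Carrier.bracket_e_e_zero b, smul_zero, smul_zero]
      · exact fun h3 => h1 (by rw [(pairingIn_eq_neg_two_iff hs).1 h3, neg_add_cancel])
      · exact fun h3 => h2 ⟨_, root_reflectionPerm_of_pairingIn_eq_neg_one h3⟩
  have hli : LinearIndependent ℂ (Sum.elim x fun i : b.support => h i) := by
    let w : ι ⊕ b.support → ℂˣ := Sum.elim (fun α => Units.map (Int.castRingHom ℂ) (s α)) 1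
    convert (Carrier.basis b).linearIndependent.units_smul w using 1
    funext k
    rcases k with α | i
    · simp only [Sum.elim_inl, Pi.smul_apply', w, x]
      rcases hs2 α with e1 | e1 <;> simp [e1, Carrier.e]
    · simp only [Sum.elim_inr, Pi.smul_apply', w, h, Pi.one_apply, one_smul]
      exact Carrier.cartan_simple b i
  exact ⟨Carrier b, inferInstance, inferInstance, x, h,
    ⟨hspan'.isSimple b hs hli hspan, hspan', hli, hspan, hx_add⟩⟩

end Simple

section Classical

variable {ι M N : Type*} [AddCommGroup M] [Module ℝ M] [AddCommGroup N] [Module ℝ N]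
  {P : RootPairing ι ℝ M N} [P.IsCrystallographic]

theorem IsChevalleySpanningSet.map {F K L : Type*} [Field F] [LieRing K] [LieAlgebra F K]
    [LieRing L] [LieAlgebra F L] {x h : ι → K} (hx : IsChevalleySpanningSet P F x h)
    (φ : K →ₗ⁅F⁆ L) (hφ : Function.Surjective φ) :
    IsChevalleySpanningSet P F (fun α => φ (x α)) (fun α => φ (h α)) where
  span_eq_top := by
    have h1 := congrArg (Submodule.map (φ : K →ₗ[F] L)) hx.span_eq_top
    rw [Submodule.map_span, Submodule.map_top, LinearMap.range_eq_top.2 hφ, Set.image_union,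
      ← Set.range_comp, ← Set.range_comp] at h1
    exact h1
  lie_h_h α β := by rw [← LieHom.map_lie, hx.lie_h_h, map_zero]
  lie_h_x α β := by rw [← LieHom.map_lie, hx.lie_h_x, map_smul]
  lie_x_neg α β h := by rw [← LieHom.map_lie, hx.lie_x_neg α β h]
  lie_x_x α β γ h := by
    obtain ⟨A, hA, h1⟩ := hx.lie_x_x α β γ h
    exact ⟨A, hA, by rw [← LieHom.map_lie, h1, map_smul]⟩
  lie_x_x_eq_zero α β h h' := by
    rw [← LieHom.map_lie, hx.lie_x_x_eq_zero α β h h', map_zero]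

namespace IsChevalleyBasis

variable {b : P.Base} {g : Type*} [LieRing g] [LieAlgebra ℂ g] {x h : ι → g}
  (hb : IsChevalleyBasis b x h)

/-- The root elements of the lattice `g_ℤ`. -/
def latticeX (α : ι) : hb.lattice := ⟨x α, Submodule.subset_span (Or.inl ⟨α, rfl⟩)⟩

/-- The Cartan elements of the lattice `g_ℤ`. -/
def latticeH (α : ι) : hb.lattice :=
  ⟨h α, Submodule.span_mono Set.subset_union_right (hb.h_mem_span α)⟩

/-- The Chevalley basis, as a basis of the lattice `g_ℤ`. -/
noncomputable def latticeBasis : Module.Basis (ι ⊕ b.support) ℤ hb.lattice :=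
  Module.Basis.mk (v := Sum.elim hb.latticeX fun i => hb.latticeH i)
    (by
      refine LinearIndependent.of_comp hb.lattice.toSubmodule.subtype ?_
      convert hb.linearIndependent.restrict_scalars' ℤ using 1
      · funext k
        rcases k with α | i <;> rfl
      · exact Subsingleton.elim _ _)
    (by
      rintro ⟨z, hz⟩ -
      have key : Submodule.span ℤ (Set.range x ∪ h '' b.support) ≤
          (Submodule.span ℤ (Set.range
            (Sum.elim hb.latticeX fun i : b.support => hb.latticeH i))).map
              hb.lattice.toSubmodule.subtype := by
        rw [Submodule.span_le]
        rintro _ (⟨α, rfl⟩ | ⟨i, hi, rfl⟩)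
        · exact ⟨hb.latticeX α, Submodule.subset_span ⟨Sum.inl α, rfl⟩, rfl⟩
        · exact ⟨hb.latticeH i, Submodule.subset_span ⟨Sum.inr ⟨i, hi⟩, rfl⟩, rfl⟩
      obtain ⟨w, hw, hwz⟩ := key hz
      have hwz' : w = ⟨z, hz⟩ := Subtype.ext hwz
      rwa [← hwz'])

variable (F : Type*) [Field F]

theorem baseChange_elim : (Sum.elim (fun α => (1 : F) ⊗ₜ[ℤ] hb.latticeX α)
    fun i : b.support => (1 : F) ⊗ₜ[ℤ] hb.latticeH i) = hb.latticeBasis.baseChange F := by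
  funext k
  rcases k with α | i <;> simp [latticeBasis]

theorem linearIndependent_baseChange :
    LinearIndependent F (Sum.elim (fun α => (1 : F) ⊗ₜ[ℤ] hb.latticeX α)
      fun i : b.support => (1 : F) ⊗ₜ[ℤ] hb.latticeH i) := by
  rw [baseChange_elim]
  exact Module.Basis.linearIndependent _

theorem span_baseChange :
    Submodule.span F (Set.range (fun α => (1 : F) ⊗ₜ[ℤ] hb.latticeX α) ∪
      (fun α => (1 : F) ⊗ₜ[ℤ] hb.latticeH α) '' b.support) = ⊤ := by
  have h1 := (hb.latticeBasis.baseChange F).span_eq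
  rw [← baseChange_elim, Set.Sum.elim_range] at h1
  rw [Set.image_eq_range]
  exact h1

theorem isChevalleySpanningSet_baseChange :
    IsChevalleySpanningSet P F (fun α => (1 : F) ⊗ₜ[ℤ] hb.latticeX α)
      (fun α => (1 : F) ⊗ₜ[ℤ] hb.latticeH α) where
  span_eq_top := by
    rw [eq_top_iff, ← hb.span_baseChange F]
    exact Submodule.span_mono (Set.union_subset_union_right _ (Set.image_subset_range _ _))
  lie_h_h α β := by
    have : ⁅hb.latticeH α, hb.latticeH β⁆ = 0 := Subtype.ext (hb.isChevalleySpanningSet.lie_h_h α β)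
    rw [LieAlgebra.ExtendScalars.bracket_tmul, this, TensorProduct.tmul_zero]
  lie_h_x α β := by
    have : ⁅hb.latticeH α, hb.latticeX β⁆ = P.pairingIn ℤ α β • hb.latticeX β := Subtype.ext <| by
      refine (hb.isChevalleySpanningSet.lie_h_x α β).trans ?_
      rw [Int.cast_smul_eq_zsmul]
      rfl
    rw [LieAlgebra.ExtendScalars.bracket_tmul, this, TensorProduct.tmul_smul, mul_one,
      Int.cast_smul_eq_zsmul]
  lie_x_neg α β h0 := by
    have : ⁅hb.latticeX α, hb.latticeX β⁆ = hb.latticeH α :=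
      Subtype.ext (hb.isChevalleySpanningSet.lie_x_neg α β h0)
    rw [LieAlgebra.ExtendScalars.bracket_tmul, this, mul_one]
  lie_x_x α β γ h0 := by
    rcases hb.lie_x_x_eq_or α β γ h0 with h1 | h1
    · have : ⁅hb.latticeX α, hb.latticeX β⁆ = hb.latticeX γ := Subtype.ext h1
      exact ⟨1, one_ne_zero, by
        rw [LieAlgebra.ExtendScalars.bracket_tmul, this, mul_one, one_smul]⟩
    · have : ⁅hb.latticeX α, hb.latticeX β⁆ = -hb.latticeX γ := Subtype.ext h1
      exact ⟨-1, neg_ne_zero.2 one_ne_zero, by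
        rw [LieAlgebra.ExtendScalars.bracket_tmul, this, mul_one, neg_smul, one_smul,
          TensorProduct.tmul_neg]⟩
  lie_x_x_eq_zero α β h0 h1 := by
    have : ⁅hb.latticeX α, hb.latticeX β⁆ = 0 :=
      Subtype.ext (hb.isChevalleySpanningSet.lie_x_x_eq_zero α β h0 h1)
    rw [LieAlgebra.ExtendScalars.bracket_tmul, this, TensorProduct.tmul_zero]

variable {F} {L : Type*} [LieRing L] [LieAlgebra F L]

theorem IsClassical.hasChevalleySpanningSet {hb : IsChevalleyBasis b x h}
    (hL : hb.IsClassical F L) : HasChevalleySpanningSet P F L := by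
  obtain ⟨-, I, ⟨e⟩⟩ := hL
  let π : (F ⊗[ℤ] hb.lattice) →ₗ⁅F⁆ (F ⊗[ℤ] hb.lattice) ⧸ I :=
    { (LieSubmodule.Quotient.mk' I : F ⊗[ℤ] hb.lattice →ₗ[F] (F ⊗[ℤ] hb.lattice) ⧸ I) with
      map_lie' := fun {y z} => LieSubmodule.Quotient.mk_bracket I y z }
  have h1 := (hb.isChevalleySpanningSet_baseChange F).map π
    (LieSubmodule.Quotient.surjective_mk' I)
  exact ⟨_, _, h1.map e.symm.toLieHom e.symm.surjective⟩

theorem isClassical_of_forall_ne_zero [Finite ι] [P.IsRootSystem] [P.IsReduced] [P.IsIrreducible]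
    (hs : ∀ α β, P.pairingIn ℤ α β = P.pairingIn ℤ β α) [Nontrivial L] {x' h' : ι → L}
    (hx : IsChevalleySpanningSet P F x' h') (hx0 : ∀ α, x' α ≠ 0) : hb.IsClassical F L := by
  obtain ⟨φ, hφ⟩ := (hb.isChevalleySpanningSet_baseChange F).exists_surjective_lieHom b hs
    (hb.linearIndependent_baseChange F) (hb.span_baseChange F) hx hx0
  refine ⟨inferInstance, φ.ker, ⟨?_⟩⟩
  have e := φ.quotKerEquivRange
  have hr : φ.range = ⊤ := (LieHom.range_eq_top φ).2 hφ
  rw [hr] at e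
  exact (e.trans LieSubalgebra.topEquiv).symm

end IsChevalleyBasis

end Classical

end SimplyLaced

theorem mainTheorem2
    {ι : Type u} {M N : Type*} [Finite ι]
    [AddCommGroup M] [Module ℝ M] [AddCommGroup N] [Module ℝ N]
    (P : RootPairing ι ℝ M N) [P.IsRootSystem] [P.IsCrystallographic] [P.IsReduced]
    [P.IsIrreducible] (b : P.Base) (hP : b.cartanMatrix.IsSimplyLaced) :
    -- there is a simple complex Lie algebra with a Chevalley basis of the type of `P`,
    (∃ (g : Type u) (_ : LieRing g) (_ : LieAlgebra ℂ g) (x h : ι → g),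
      SimplyLaced.IsChevalleyBasis b x h) ∧
    -- and for every choice of it, the equivalence holds.
    ∀ {g : Type*} [LieRing g] [LieAlgebra ℂ g] {x h : ι → g}
      (hb : SimplyLaced.IsChevalleyBasis b x h)
      {F : Type*} [Field F] {L : Type*} [LieRing L] [LieAlgebra F L],
      (Nontrivial L ∧ SimplyLaced.HasChevalleySpanningSet P F L ↔ hb.IsClassical F L) ∧
      -- moreover the `x α` in the spanning set may be required to be nonzero
      ((∃ x' h' : ι → L, SimplyLaced.IsChevalleySpanningSet P F x' h' ∧ ∀ α, x' α ≠ 0) ↔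
        hb.IsClassical F L) := by
  have hs := SimplyLaced.pairingIn_comm b hP
  refine ⟨SimplyLaced.exists_isChevalleyBasis P b hs, fun {g} _ _ {x h} hb {F} _ {L} _ _ => ?_⟩
  refine ⟨⟨fun ⟨hL, x', h', hx⟩ => ?_, fun hL => ⟨hL.1, hL.hasChevalleySpanningSet⟩⟩,
    fun ⟨x', h', hx, hx0⟩ => ?_, fun hL => ?_⟩
  · obtain ⟨x'', h'', hx'', hx0⟩ := hx.exists_forall_ne_zero hs
    exact hb.isClassical_of_forall_ne_zero hs hx'' hx0
  · obtain ⟨α⟩ := SimplyLaced.nonempty_of_isIrreducible P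
    have : Nontrivial L := ⟨x' α, 0, hx0 α⟩
    exact hb.isClassical_of_forall_ne_zero hs hx hx0
  · have := hL.1
    obtain ⟨x', h', hx⟩ := hL.hasChevalleySpanningSet
    exact hx.exists_forall_ne_zero hs
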